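/- Let $\mathbb N=\{1,2,\dots\}$, $\mathbb N_0=\{0,1,2,\dots\}$, and let $K:\mathbb N_0\times\mathbb N_0\to[0,\infty)$ be symmetric and bounded with $K(0,\ell)=0$ for all $\ell\in\mathbb N_0$. For $n\in\mathbb N$ let $\Omega_n=\mathbb N_0^{\{1,\dots,n\}}$, and for $f:\Omega_n\to\mathbb R$ let $$L_nf(\eta)=\frac1n\sum_{x=1}^n\sum_{y\neq x}K(\eta_x,\eta_y)\big(f(\eta+\eta_x(\delta_y-\delta_x))-f(\eta)\big),$$ where $\delta_x\in\Omega_n$ is the configuration with value $1$ at $x$ and $0$ elsewhere. Let $(\eta^n(t);t\ge0)$ be a càdlàg continuous-time Markov chain on $\Omega_n$ generated by $L_n$ (that is, with transition semigroup $e^{tL_n}$ on bounded functions), started from the configuration with $\eta^n_x(0)=1$ for all $x$, and let $$\pi^n_t(\ell)=\frac1n\,\#\{x:\eta^n_x(t)=\ell\},\qquad t\ge0,\ \ell\in\mathbb N.$$ Let $\mathcal M_+=\{u:\mathbb N\to[0,\infty):\sum_{\ell\ge1}u_\ell\le1\}$ with the metric of $\ell^1(\mathbb N)$, and for $u\in\ell^1(\mathbb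 N)$ let $$(\mathcal Ku)_\ell=\sum_{i=1}^{\ell-1}K(i,\ell-i)u_iu_{\ell-i}-2\sum_{i=1}^\infty K(\ell,i)u_\ell u_i,\qquad \ell\in\mathbb N,$$ which defines an element $\mathcal Ku$ of $\ell^1(\mathbb N)$. Then for every $T>0$ there is exactly one $u\in C([0,T];\mathcal M_+)$ with $u(0)=\delta_1$ (the unit mass at $\ell=1$) that is a weak solution of the Smoluchowski equation, that is, $$u(t)=u(0)+\int_0^t\mathcal Ku(s)\,ds\quad\text{in }\ell^1(\mathbb N)\text{ for every }t\in[0,T],$$ and, as $n\to\infty$, the random paths $(\pi^n_t;t\in[0,T])$ converge to $u$ in probability with respect to the $J_1$-Skorohod topology of $D([0,T];\mathcal M_+)$. -/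

import Mathlib

open MeasureTheory Filter Topology
open scoped NNReal ENNReal

noncomputable section

/-! ### Coagulation kernels -/

/-- A coagulation kernel: a symmetric, bounded function `K : ℕ₀ × ℕ₀ → [0, ∞)` with
`K(0, ℓ) = 0` for every `ℓ`. -/
structure CoagulationKernel where
  toFun : ℕ → ℕ → ℝ
  nonneg : ∀ i j, 0 ≤ toFun i j
  symm : ∀ i j, toFun i j = toFun j i
  bounded : ∃ C : ℝ, ∀ i j, toFun i j ≤ C
  zero_left : ∀ j, toFun 0 j = 0

instance : CoeFun CoagulationKernel (fun _ => ℕ → ℕ → ℝ) := ⟨CoagulationKernel.toFun⟩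

/-! ### The Marcus–Lushnikov chain -/

/-- Configurations on `n` sites: `η x` is the mass at the site `x` (`0` if there is no particle). -/
abbrev Config (n : ℕ) : Type := Fin n → ℕ

/-- The configuration `η + η_x (δ_y - δ_x)`, for `x ≠ y`. -/
def Config.merge {n : ℕ} (η : Config n) (x y : Fin n) : Config n :=
  fun z => if z = x then 0 else if z = y then η y + η x else η z

/-- The monodisperse configuration: one particle of mass one at each site. -/
def Config.mono (n : ℕ) : Config n := fun _ => 1

/-- The operator
`L_n f(η) = (1/n) ∑_x ∑_{y ≠ x} K(η_x, η_y) (f(η + η_x (δ_y - δ_x)) - f(η))`. -/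
def generator (K : CoagulationKernel) (n : ℕ) (f : Config n → ℝ) (η : Config n) : ℝ :=
  (1 / (n : ℝ)) * ∑ x : Fin n, ∑ y ∈ Finset.univ.erase x,
    K (η x) (η y) * (f (η.merge x y) - f η)

/-- The transition semigroup `exp(t L_n) f = ∑_k (t^k / k!) L_n^k f` generated by `L_n`. As the
jump rates of `L_n` are bounded, the series converges absolutely for every bounded `f`. -/
def transitionSemigroup (K : CoagulationKernel) (n : ℕ) (t : ℝ≥0) (f : Config n → ℝ)
    (η : Config n) : ℝ :=
  ∑' k : ℕ, (t : ℝ) ^ k / (k.factorial : ℝ) * ((generator K n)^[k] f) η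

/-- A path is càdlàg if it is right-continuous and has left limits. -/
def IsCadlag {ι E : Type*} [TopologicalSpace ι] [Preorder ι] [TopologicalSpace E]
    (f : ι → E) : Prop :=
  ∀ t, ContinuousWithinAt f (Set.Ici t) t ∧ ∃ l, Tendsto f (𝓝[<] t) (𝓝 l)

/-- The σ-algebra generated by the process up to time `s`. -/
abbrev pastSigmaAlgebra {Ω E : Type*} [MeasurableSpace E] (X : ℝ≥0 → Ω → E) (s : ℝ≥0) :
    MeasurableSpace Ω :=
  ⨆ r : Set.Iic s, MeasurableSpace.comap (X r) inferInstance

/-- `X` is a càdlàg continuous-time Markov chain generated by `L_n` and started from the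
monodisperse configuration: it has the Markov property with respect to its own filtration, with
transition semigroup `exp(t L_n)`. -/
structure IsMarcusLushnikov (K : CoagulationKernel) (n : ℕ) {Ω : Type*} [MeasurableSpace Ω]
    (P : Measure Ω) (X : ℝ≥0 → Ω → Config n) : Prop where
  measurable : ∀ t, Measurable (X t)
  cadlag : ∀ ω, IsCadlag (fun t => X t ω)
  initial : ∀ᵐ ω ∂P, X 0 ω = Config.mono n
  markov : ∀ (s h : ℝ≥0) (f : Config n → ℝ), (∃ C : ℝ, ∀ η, |f η| ≤ C) →
    P[fun ω => f (X (s + h) ω) | pastSigmaAlgebra X s]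
      =ᵐ[P] fun ω => transitionSemigroup K n h f (X s ω)

/-! ### The space of subprobability measures on `{1, 2, …}` -/

/-- The space `ℓ¹(ℕ)`, `ℕ = {1, 2, …}`. -/
abbrev EllOne : Type := lp (fun _ : ℕ+ => ℝ) 1

/-- The set `M₊` of subprobability measures on `{1, 2, …}`, with the metric of `ℓ¹`. -/
def MPlus : Set EllOne := {u | (∀ ℓ, 0 ≤ u ℓ) ∧ ∑' ℓ, u ℓ ≤ 1}

/-- The point mass at `1`. -/
def deltaOne : EllOne := lp.single 1 (1 : ℕ+) (1 : ℝ)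

lemma memlp_one_iff (f : ℕ+ → ℝ) : Memℓp f 1 ↔ Summable fun ℓ => |f ℓ| := by
  rw [memℓp_gen_iff (by norm_num)]
  simp

/-- The number `N_ℓ(η)` of particles of mass `ℓ`. -/
def particleCount {n : ℕ} (η : Config n) (ℓ : ℕ) : ℕ :=
  (Finset.univ.filter fun x => η x = ℓ).card

lemma hasSum_empirical {n : ℕ} (η : Config n) :
    HasSum (fun ℓ : ℕ+ => (particleCount η ℓ : ℝ) / n)
      (∑ x : Fin n, (if 0 < η x then 1 else 0) / (n : ℝ)) := by
  have h : ∀ ℓ : ℕ+, (particleCount η ℓ : ℝ) / n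
      = ∑ x : Fin n, (if η x = ℓ then 1 else 0) / (n : ℝ) := by
    intro ℓ
    rw [← Finset.sum_div, particleCount, Finset.card_filter]
    push_cast
    rfl
  simp_rw [h]
  refine hasSum_sum fun x _ => ?_
  refine HasSum.div_const ?_ _
  by_cases hx : 0 < η x
  · rw [if_pos hx]
    obtain ⟨m, hm⟩ : ∃ m : ℕ+, (m : ℕ) = η x := ⟨⟨η x, hx⟩, rfl⟩
    have he : (fun ℓ : ℕ+ => if η x = ℓ then (1 : ℝ) else 0)
        = fun ℓ : ℕ+ => if ℓ = m then (1 : ℝ) else 0 := by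
      funext ℓ
      exact if_congr (by rw [← hm, PNat.coe_inj, eq_comm]) rfl rfl
    rw [he]
    exact hasSum_ite_eq _ _
  · rw [if_neg hx]
    convert hasSum_zero using 2 with ℓ
    rw [if_neg]
    have := ℓ.pos
    omega

/-- The empirical density `ℓ ↦ N_ℓ(η) / n`, as an element of `M₊`. -/
def empiricalDensity {n : ℕ} (η : Config n) : MPlus :=
  ⟨⟨fun ℓ : ℕ+ => (particleCount η ℓ : ℝ) / n, by
      refine (memlp_one_iff _).2 ((hasSum_empirical η).summable.congr fun ℓ => ?_)
      rw [abs_of_nonneg (by positivity)]⟩,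
    fun ℓ => by
      show 0 ≤ (particleCount η ℓ : ℝ) / n
      positivity,
    by
      show ∑' ℓ : ℕ+, (particleCount η ℓ : ℝ) / n ≤ 1
      rw [(hasSum_empirical η).tsum_eq, ← Finset.sum_div]
      refine div_le_one_of_le₀ ?_ (by positivity)
      calc (∑ x : Fin n, if 0 < η x then (1 : ℝ) else 0) ≤ ∑ x : Fin n, (1 : ℝ) :=
            Finset.sum_le_sum fun x _ => by split_ifs <;> norm_num
        _ = n := by simp⟩

/-! ### The Smoluchowski equation -/

/-- The `ℓ`-th coordinate
`∑_{i=1}^{ℓ-1} K(i, ℓ-i) u_i u_{ℓ-i} - 2 ∑_{i=1}^∞ K(ℓ, i) u_ℓ u_i`. -/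
def smoluchowskiCoord (K : CoagulationKernel) (u : ℕ+ → ℝ) (ℓ : ℕ+) : ℝ :=
  ∑ i ∈ Finset.Ico 1 ℓ, K i (ℓ - i : ℕ+) * u i * u (ℓ - i)
    - 2 * ∑' i : ℕ+, K ℓ i * u ℓ * u i

lemma memlp_smoluchowskiCoord (K : CoagulationKernel) (u : EllOne) :
    Memℓp (smoluchowskiCoord K u) 1 := by
  obtain ⟨C, hC⟩ := K.bounded
  have hu : Summable fun ℓ => |u ℓ| := (memlp_one_iff _).1 u.2
  have huu : Summable fun p : ℕ+ × ℕ+ => |u p.1| * |u p.2| :=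
    hu.mul_of_nonneg hu (fun _ => abs_nonneg _) (fun _ => abs_nonneg _)
  have hK : ∀ a b (i j : ℕ+), |K a b * u i * u j| ≤ C * (|u i| * |u j|) := by
    intro a b i j
    rw [abs_mul, abs_mul, abs_of_nonneg (K.nonneg a b), mul_assoc]
    exact mul_le_mul_of_nonneg_right (hC a b) (by positivity)
  rw [memlp_one_iff]
  have h1 : Summable fun ℓ : ℕ+ =>
      |∑ i ∈ Finset.Ico 1 ℓ, K i (ℓ - i : ℕ+) * u i * u (ℓ - i)| := by
    let φ : (Σ ℓ : ℕ+, {i // i ∈ Finset.Ico 1 ℓ}) → ℕ+ × ℕ+ := fun p => (p.2.1, p.1 - p.2.1)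
    have hφ : Function.Injective φ := by
      rintro ⟨ℓ, i, hi⟩ ⟨m, j, hj⟩ h
      simp only [φ, Prod.mk.injEq] at h
      obtain ⟨rfl, h⟩ := h
      have hl := PNat.add_sub_of_lt (Finset.mem_Ico.1 hi).2
      have hm := PNat.add_sub_of_lt (Finset.mem_Ico.1 hj).2
      have : ℓ = m := by rw [← hl, ← hm, h]
      subst this
      rfl
    have hs := ((huu.comp_injective hφ).mul_left C).sigma
    refine Summable.of_nonneg_of_le (fun _ => abs_nonneg _) (fun ℓ => ?_) hs
    rw [tsum_fintype]
    simp only [Function.comp_apply, φ]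
    rw [Finset.univ_eq_attach,
      Finset.sum_attach (Finset.Ico 1 ℓ) (fun i => C * (|u i| * |u (ℓ - i)|))]
    exact (Finset.abs_sum_le_sum_abs _ _).trans (Finset.sum_le_sum fun i _ => hK _ _ _ _)
  have h2 : Summable fun ℓ : ℕ+ => |2 * ∑' i : ℕ+, K ℓ i * u ℓ * u i| := by
    refine Summable.of_nonneg_of_le (fun _ => abs_nonneg _) (fun ℓ => ?_)
      ((huu.mul_left C).prod.mul_left 2)
    rw [abs_mul, abs_two]
    refine mul_le_mul_of_nonneg_left ?_ zero_le_two
    have hb : Summable fun i : ℕ+ => C * (|u ℓ| * |u i|) := (hu.mul_left _).mul_left _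
    have := tsum_of_norm_bounded (f := fun i : ℕ+ => K ℓ i * u ℓ * u i) hb.hasSum
      fun i => hK ℓ i ℓ i
    exact this
  refine Summable.of_nonneg_of_le (fun _ => abs_nonneg _) (fun ℓ => ?_) (h1.add h2)
  exact abs_sub _ _

/-- The operator `𝒦 : ℓ¹ → ℓ¹` on the right-hand side of the Smoluchowski equation. -/
def smoluchowskiOp (K : CoagulationKernel) (u : EllOne) : EllOne :=
  ⟨smoluchowskiCoord K u, memlp_smoluchowskiCoord K u⟩

/-- `u ∈ C([0,T]; M₊)` is a weak solution of the Smoluchowski equation: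
`u(t) = u(0) + ∫₀ᵗ 𝒦 u(s) ds` in `ℓ¹` for every `t ∈ [0,T]`. -/
def IsWeakSolution (K : CoagulationKernel) {T : ℝ} (hT : 0 ≤ T)
    (u : C(Set.Icc 0 T, MPlus)) : Prop :=
  ∀ t : Set.Icc 0 T, (u t : EllOne) = (u ⟨0, Set.left_mem_Icc.2 hT⟩ : EllOne)
    + ∫ s in (0 : ℝ)..t, smoluchowskiOp K (u (Set.projIcc 0 T hT s))

/-! ### The Skorohod space -/

/-- The space `D([0,T]; E)` of càdlàg paths. -/
structure SkorohodSpace (T : ℝ) (E : Type*) [TopologicalSpace E] where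
  toFun : Set.Icc 0 T → E
  cadlag : IsCadlag toFun

/-- The `J₁`-metric
`d(x, y) = inf_λ max (sup_t |λ(t) - t|) (sup_t d(x(t), y(λ(t))))`, where `λ` ranges over the
increasing bijections of `[0,T]`; its topology is the `J₁`-topology. -/
instance (T : ℝ) (E : Type*) [PseudoEMetricSpace E] :
    PseudoEMetricSpace (SkorohodSpace T E) where
  edist x y := ⨅ l : Set.Icc 0 T ≃o Set.Icc 0 T,
    max (⨆ t, edist (l t) t) (⨆ t, edist (x.toFun t) (y.toFun (l t)))
  edist_self x := by
    refine le_antisymm (iInf_le_of_le (OrderIso.refl _) ?_) zero_le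
    simp
  edist_comm := by
    have key : ∀ x y : SkorohodSpace T E,
        (⨅ l : Set.Icc 0 T ≃o Set.Icc 0 T,
          max (⨆ t, edist (l t) t) (⨆ t, edist (x.toFun t) (y.toFun (l t))))
        ≤ ⨅ l : Set.Icc 0 T ≃o Set.Icc 0 T,
          max (⨆ t, edist (l t) t) (⨆ t, edist (y.toFun t) (x.toFun (l t))) := by
      intro x y
      refine le_iInf fun l => iInf_le_of_le l.symm (max_le_max ?_ ?_)
      · refine iSup_le fun t => le_iSup_of_le (l.symm t) ?_
        rw [OrderIso.apply_symm_apply, edist_comm]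
      · refine iSup_le fun t => le_iSup_of_le (l.symm t) ?_
        rw [OrderIso.apply_symm_apply, edist_comm]
    exact fun x y => le_antisymm (key x y) (key y x)
  edist_triangle x y z := by
    refine ENNReal.le_iInf_add_iInf fun l m => ?_
    refine iInf_le_of_le (l.trans m) (max_le ?_ ?_)
    · refine iSup_le fun t => (edist_triangle _ (l t) _).trans ?_
      rw [add_comm, OrderIso.trans_apply]
      exact add_le_add (le_max_of_le_left (le_iSup (fun t => edist (l t) t) t))
        (le_max_of_le_left (le_iSup (fun t => edist (m t) t) (l t)))
    · refine iSup_le fun t => (edist_triangle _ (y.toFun (l t)) _).trans ?_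
      rw [OrderIso.trans_apply]
      exact add_le_add
        (le_max_of_le_right (le_iSup (fun t => edist (x.toFun t) (y.toFun (l t))) t))
        (le_max_of_le_right (le_iSup (fun t => edist (y.toFun t) (z.toFun (m t))) (l t)))

/-- Continuous paths are càdlàg: `C([0,T]; E) ⊆ D([0,T]; E)`. -/
def SkorohodSpace.ofContinuous {T : ℝ} {E : Type*} [TopologicalSpace E]
    (u : C(Set.Icc 0 T, E)) : SkorohodSpace T E where
  toFun := u
  cadlag t := ⟨u.continuous.continuousWithinAt,
    u t, (u.continuous.tendsto t).mono_left nhdsWithin_le_nhds⟩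

lemma IsCadlag.comp {ι κ E F : Type*} [TopologicalSpace ι] [Preorder ι] [TopologicalSpace κ]
    [PartialOrder κ] [TopologicalSpace E] [TopologicalSpace F] {f : ι → E} (hf : IsCadlag f)
    {g : κ → ι} (hg : Continuous g) (hg' : StrictMono g) {φ : E → F} (hφ : Continuous φ) :
    IsCadlag fun t => φ (f (g t)) := by
  intro t
  obtain ⟨h1, l, hl⟩ := hf (g t)
  refine ⟨hφ.continuousAt.comp_continuousWithinAt
    (h1.comp hg.continuousWithinAt fun s hs => hg'.monotone hs), φ l, ?_⟩
  refine (hφ.tendsto l).comp (hl.comp ?_)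
  exact tendsto_nhdsWithin_iff.2 ⟨(hg.tendsto t).mono_left nhdsWithin_le_nhds,
    eventually_nhdsWithin_of_forall fun s hs => hg' hs⟩

/-- The path `(π_t; t ∈ [0,T])`, `π_t(ℓ) = N_ℓ(η(t)) / n`, as an element of `D([0,T]; M₊)`. -/
def empiricalPath (T : ℝ) {n : ℕ} (η : ℝ≥0 → Config n) (hη : IsCadlag η) :
    SkorohodSpace T MPlus where
  toFun t := empiricalDensity (η ⟨t, t.2.1⟩)
  cadlag := hη.comp (g := fun t : Set.Icc 0 T => (⟨t, t.2.1⟩ : ℝ≥0))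
    (continuous_subtype_val.subtype_mk _) (fun _ _ h => h) continuous_of_discreteTopology

/-- Convergence in probability to a deterministic limit, for random elements `X n` that may be
defined on different probability spaces. -/
def TendstoInProbability {ι : Type*} [Preorder ι] {S : Type*} [PseudoEMetricSpace S]
    {Ω : ι → Type*} [∀ n, MeasurableSpace (Ω n)] (P : ∀ n, Measure (Ω n))
    (X : ∀ n, Ω n → S) (x : S) : Prop :=
  ∀ ε : ℝ≥0∞, 0 < ε → Tendsto (fun n => P n {ω | ε ≤ edist (X n ω) x}) atTop (𝓝 0)

end

noncomputable section

/-! ### The space `ℓ¹` -/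

/-! Write C for `K.bound`. The operator 𝒦 is the diagonal of a bounded bilinear map on ℓ¹, the sum
of K(i,j) u_i v_j (δ_{i+j} - δ_i - δ_j) (`smoluchowskiOp_eq`), hence Lipschitz on M₊. An Euler step
of length at most 1/(2C) preserves M₊, and the mild form of the equation writes the solution as an
average of the initial value and of such Euler steps. Picard iteration therefore stays in M₊ and
converges on all of [0,T]; Grönwall's inequality gives uniqueness.

For the chain, each density N_ℓ/n is followed along a time grid of mesh h. Its increment is a
conditional drift plus a fluctuation. The drift is h times the ℓ-th coordinate of 𝒦 at the empirical
density, up to errors h·O(1/n) and O(h²). The fluctuations are orthogonal, with second moments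
h·O(1/n) + O(h²), because a jump has size O(1/n) and jumps occur at rate O(n). The O(h²) constants
may depend badly on n: h tends to 0 while n is fixed (`IsMarcusLushnikov.integral_deviation_le`), so
the power series of the semigroup is all that is needed from continuous time.

Only the masses ℓ ≤ L are treated in this way. Conservation of mass bounds the rest of the empirical
density by 1/L, and Dini's theorem makes the tails of u uniformly small. A discrete Grönwall
inequality bounds the expected ℓ¹ distance at a fixed time; n tends to infinity for fixed L, and L
is taken large.

No maximal inequality is needed for uniformity in time. A coagulation moves the empirical density by
at most 3/n in ℓ¹ and removes exactly one particle, so the displacement between two grid times is at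
most three times the loss of particle density, which the deviations at the two grid times control
(`deviation_le_of_grid`). A finite grid, Markov's inequality and the identity as time change finish
the proof. -/

lemma EllOne.summable_abs (u : EllOne) : Summable fun ℓ => |u ℓ| := (memlp_one_iff _).1 u.2

lemma EllOne.norm_eq (u : EllOne) : ‖u‖ = ∑' ℓ, |u ℓ| := by
  rw [lp.norm_eq_tsum_rpow (by norm_num)]
  simp

lemma EllOne.abs_apply_le (u : EllOne) (ℓ : ℕ+) : |u ℓ| ≤ ‖u‖ :=
  lp.norm_apply_le_norm (by norm_num) u ℓ

lemma EllOne.sum_abs_le (u : EllOne) (s : Finset ℕ+) : ∑ ℓ ∈ s, |u ℓ| ≤ ‖u‖ := by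
  rw [u.norm_eq]
  exact u.summable_abs.sum_le_tsum s fun _ _ => abs_nonneg _

/-- The coordinate functional `u ↦ u_ℓ` on `ℓ¹`. -/
def EllOne.coord (ℓ : ℕ+) : EllOne →L[ℝ] ℝ := lp.evalCLM ℝ (fun _ : ℕ+ => ℝ) 1 ℓ

@[simp] lemma EllOne.coord_apply (ℓ : ℕ+) (u : EllOne) : EllOne.coord ℓ u = u ℓ := rfl

/-- The total mass `u ↦ ∑_ℓ u_ℓ` on `ℓ¹`. -/
def EllOne.total : EllOne →L[ℝ] ℝ :=
  LinearMap.mkContinuous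
    { toFun := fun u => ∑' ℓ, u ℓ
      map_add' := fun u v => by
        simpa using u.summable_abs.of_abs.tsum_add v.summable_abs.of_abs
      map_smul' := fun c u => by
        simp [tsum_mul_left] } 1 fun u => by
    rw [one_mul, u.norm_eq]
    exact norm_tsum_le_tsum_norm (by simpa using u.summable_abs)

lemma EllOne.total_apply (u : EllOne) : EllOne.total u = ∑' ℓ, u ℓ := rfl

lemma EllOne.abs_total_le (u : EllOne) : |EllOne.total u| ≤ ‖u‖ := by
  rw [u.norm_eq, EllOne.total_apply]
  exact norm_tsum_le_tsum_norm (f := fun ℓ => u ℓ) (by simpa using u.summable_abs)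

lemma norm_eq_total_of_mem {u : EllOne} (hu : u ∈ MPlus) : ‖u‖ = EllOne.total u := by
  rw [u.norm_eq, EllOne.total_apply]
  exact tsum_congr fun ℓ => abs_of_nonneg (hu.1 ℓ)

lemma norm_le_one_of_mem {u : EllOne} (hu : u ∈ MPlus) : ‖u‖ ≤ 1 :=
  (norm_eq_total_of_mem hu).trans_le hu.2

lemma mem_MPlus_iff {u : EllOne} :
    u ∈ MPlus ↔ (∀ ℓ, 0 ≤ EllOne.coord ℓ u) ∧ EllOne.total u ≤ 1 := Iff.rfl

/-- Closedness makes C([0,T]; M₊) complete, as the contraction principle requires. -/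
lemma isClosed_MPlus : IsClosed MPlus := by
  have : MPlus = (⋂ ℓ, {u | 0 ≤ EllOne.coord ℓ u}) ∩ {u | EllOne.total u ≤ 1} := by
    ext u
    simp [mem_MPlus_iff]
  rw [this]
  exact (isClosed_iInter fun ℓ => isClosed_le continuous_const (EllOne.coord ℓ).continuous).inter
    (isClosed_le EllOne.total.continuous continuous_const)

/-- Off `s`, nonnegativity gives |u_ℓ - v_ℓ| ≤ u_ℓ + v_ℓ, and each tail is a total minus a partial
sum. This reduces ℓ¹ estimates to finitely many coordinates. -/
lemma EllOne.norm_le_sum_add {u v : EllOne} (hu : u ∈ MPlus) (hv : v ∈ MPlus) (s : Finset ℕ+) :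
    ‖u - v‖ ≤ ∑ ℓ ∈ s, |u ℓ - v ℓ| + (EllOne.total u - ∑ ℓ ∈ s, u ℓ)
      + (EllOne.total v - ∑ ℓ ∈ s, v ℓ) := by
  have h1 := (u - v).summable_abs.sum_add_tsum_subtype_compl s
  have h2 := u.summable_abs.of_abs.sum_add_tsum_subtype_compl s
  have h3 := v.summable_abs.of_abs.sum_add_tsum_subtype_compl s
  have h4 : ∑' ℓ : {ℓ // ℓ ∉ s}, |(u - v) ℓ| ≤ ∑' ℓ : {ℓ // ℓ ∉ s}, u ℓ
      + ∑' ℓ : {ℓ // ℓ ∉ s}, v ℓ := by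
    refine le_of_le_of_eq ?_
      ((u.summable_abs.of_abs.subtype _).tsum_add (v.summable_abs.of_abs.subtype _))
    refine ((u - v).summable_abs.subtype _).tsum_le_tsum (fun ℓ => ?_)
      ((u.summable_abs.of_abs.subtype _).add (v.summable_abs.of_abs.subtype _))
    have := hu.1 ℓ
    have := hv.1 ℓ
    simp only [Function.comp_apply, lp.coeFn_sub, Pi.sub_apply]
    rw [abs_le]
    constructor <;> linarith
  rw [EllOne.norm_eq, ← h1, EllOne.total_apply, EllOne.total_apply, ← h2, ← h3]
  simp only [lp.coeFn_sub, Pi.sub_apply] at *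
  linarith

/-! ### Point masses -/

/-- The point mass at `m`; it vanishes if `m = 0`. -/
def pointMass : ℕ → EllOne
  | 0 => 0
  | m + 1 => lp.single 1 m.succPNat (1 : ℝ)

@[simp] lemma pointMass_zero : pointMass 0 = 0 := rfl

lemma pointMass_succ (m : ℕ) : pointMass (m + 1) = lp.single 1 m.succPNat (1 : ℝ) := rfl

lemma pointMass_one : pointMass 1 = deltaOne := rfl

lemma pointMass_apply (m : ℕ) (ℓ : ℕ+) : pointMass m ℓ = if m = ℓ then 1 else 0 := by
  rcases m with _ | m
  · rw [if_neg ℓ.pos.ne]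
    rfl
  · by_cases h : m + 1 = ℓ
    · obtain rfl : ℓ = m.succPNat := PNat.eq h.symm
      rw [if_pos h, pointMass_succ]
      exact lp.single_apply_self (E := fun _ : ℕ+ => ℝ) 1 m.succPNat (1 : ℝ)
    · rw [if_neg h, pointMass_succ]
      refine lp.single_apply_ne (E := fun _ : ℕ+ => ℝ) 1 m.succPNat (1 : ℝ) ?_
      rintro rfl
      exact h rfl

lemma norm_pointMass_succ (m : ℕ) : ‖pointMass (m + 1)‖ = 1 := by
  rw [pointMass_succ]
  exact (lp.norm_single (E := fun _ : ℕ+ => ℝ) one_pos m.succPNat (1 : ℝ)).trans norm_one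

lemma norm_pointMass_le (m : ℕ) : ‖pointMass m‖ ≤ 1 := by
  rcases m with _ | m
  · simp
  · exact (norm_pointMass_succ m).le

lemma pointMass_mem (m : ℕ) : pointMass m ∈ MPlus := by
  have h0 : ∀ ℓ, 0 ≤ pointMass m ℓ := fun ℓ => by
    rw [pointMass_apply]
    split_ifs <;> norm_num
  refine ⟨h0, ?_⟩
  refine le_trans (le_of_eq ?_) (norm_pointMass_le m)
  rw [EllOne.norm_eq]
  exact tsum_congr fun ℓ => (abs_of_nonneg (h0 ℓ)).symm

lemma total_pointMass {m : ℕ} (hm : 0 < m) : EllOne.total (pointMass m) = 1 := by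
  obtain ⟨k, rfl⟩ := Nat.exists_eq_succ_of_ne_zero hm.ne'
  rw [← norm_eq_total_of_mem (pointMass_mem _)]
  exact norm_pointMass_succ k

lemma empiricalDensity_eq {n : ℕ} (η : Config n) :
    (empiricalDensity η : EllOne) = (1 / (n : ℝ)) • ∑ x, pointMass (η x) := by
  apply lp.ext
  funext ℓ
  rw [← EllOne.coord_apply, ← EllOne.coord_apply, map_smul, map_sum]
  simp only [EllOne.coord_apply, pointMass_apply]
  show (particleCount η ℓ : ℝ) / n = _
  rw [particleCount, Finset.card_filter]
  push_cast
  rw [smul_eq_mul]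
  ring

lemma empiricalDensity_mono {n : ℕ} (hn : 0 < n) :
    (empiricalDensity (Config.mono n) : EllOne) = deltaOne := by
  rw [empiricalDensity_eq]
  have : (n : ℝ) ≠ 0 := by positivity
  simp only [Config.mono, pointMass_one, Finset.sum_const, Finset.card_univ, Fintype.card_fin]
  rw [← Nat.cast_smul_eq_nsmul ℝ, smul_smul, one_div, inv_mul_cancel₀ this, one_smul]

/-- The effect `δ_{i+j} - δ_i - δ_j` of the coagulation of two particles. -/
def coagVector (i j : ℕ) : EllOne := pointMass (i + j) - pointMass i - pointMass j

lemma norm_coagVector_le (i j : ℕ) : ‖coagVector i j‖ ≤ 3 := by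
  unfold coagVector
  have h1 := norm_pointMass_le (i + j)
  have h2 := norm_pointMass_le i
  have h3 := norm_pointMass_le j
  have h4 := norm_sub_le (pointMass (i + j) - pointMass i) (pointMass j)
  have h5 := norm_sub_le (pointMass (i + j)) (pointMass i)
  linarith

lemma total_coagVector {i j : ℕ} (hi : 0 < i) (hj : 0 < j) :
    EllOne.total (coagVector i j) = -1 := by
  rw [coagVector, map_sub, map_sub, total_pointMass hi, total_pointMass hj,
    total_pointMass (by omega)]
  norm_num

/-! ### The coagulation operator -/

/-- An upper bound of the kernel. -/
def CoagulationKernel.bound (K : CoagulationKernel) : ℝ := K.bounded.choose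

lemma CoagulationKernel.le_bound (K : CoagulationKernel) (i j : ℕ) : K i j ≤ K.bound :=
  K.bounded.choose_spec i j

lemma CoagulationKernel.bound_nonneg (K : CoagulationKernel) : 0 ≤ K.bound :=
  (K.nonneg 0 0).trans (K.le_bound 0 0)

lemma CoagulationKernel.pos_of_ne_zero (K : CoagulationKernel) {i j : ℕ} (h : K i j ≠ 0) :
    0 < i ∧ 0 < j := by
  constructor <;> refine Nat.pos_of_ne_zero ?_ <;> rintro rfl
  · exact h (K.zero_left j)
  · exact h ((K.symm _ _).trans (K.zero_left i))

lemma norm_coag_term_le (K : CoagulationKernel) (u v : EllOne) (p : ℕ+ × ℕ+) :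
    ‖(K p.1 p.2 * u p.1 * v p.2) • coagVector p.1 p.2‖
      ≤ 3 * K.bound * (|u p.1| * |v p.2|) := by
  rw [norm_smul, Real.norm_eq_abs, abs_mul, abs_mul, abs_of_nonneg (K.nonneg _ _)]
  have h1 := K.le_bound p.1 p.2
  have h2 := norm_coagVector_le p.1 p.2
  have h3 := K.nonneg p.1 p.2
  have h4 := K.bound_nonneg
  calc K p.1 p.2 * |u p.1| * |v p.2| * ‖coagVector p.1 p.2‖
      ≤ K.bound * |u p.1| * |v p.2| * 3 := by gcongr
    _ = _ := by ring

lemma summable_abs_mul_abs (u v : EllOne) :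
    Summable fun p : ℕ+ × ℕ+ => |u p.1| * |v p.2| :=
  u.summable_abs.mul_of_nonneg v.summable_abs (fun _ => abs_nonneg _) (fun _ => abs_nonneg _)

lemma summable_coag (K : CoagulationKernel) (u v : EllOne) :
    Summable fun p : ℕ+ × ℕ+ => (K p.1 p.2 * u p.1 * v p.2) • coagVector p.1 p.2 :=
  Summable.of_norm_bounded ((summable_abs_mul_abs u v).mul_left _) (norm_coag_term_le K u v)

lemma norm_tsum_coag_le (K : CoagulationKernel) (u v : EllOne) :
    ‖∑' p : ℕ+ × ℕ+, (K p.1 p.2 * u p.1 * v p.2) • coagVector p.1 p.2‖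
      ≤ 3 * K.bound * ‖u‖ * ‖v‖ := by
  refine (tsum_of_norm_bounded ((summable_abs_mul_abs u v).mul_left _).hasSum
    (norm_coag_term_le K u v)).trans_eq ?_
  rw [tsum_mul_left, mul_assoc (3 * K.bound), u.norm_eq, v.norm_eq]
  congr 1
  exact (u.summable_abs.tsum_mul_tsum v.summable_abs (summable_abs_mul_abs u v)).symm

/-- The bilinear operator `(u, v) ↦ ∑_{i,j} K(i,j) u_i v_j (δ_{i+j} - δ_i - δ_j)`. -/
def coagBilin (K : CoagulationKernel) : EllOne →L[ℝ] EllOne →L[ℝ] EllOne :=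
  LinearMap.mkContinuous₂
    (LinearMap.mk₂ ℝ
      (fun u v => ∑' p : ℕ+ × ℕ+, (K p.1 p.2 * u p.1 * v p.2) • coagVector p.1 p.2)
      (fun u u' v => by
        rw [← (summable_coag K u v).tsum_add (summable_coag K u' v)]
        refine tsum_congr fun p => ?_
        rw [← add_smul, lp.coeFn_add, Pi.add_apply]
        ring_nf)
      (fun c u v => by
        rw [← (summable_coag K u v).tsum_const_smul]
        refine tsum_congr fun p => ?_
        rw [smul_smul, lp.coeFn_smul, Pi.smul_apply, smul_eq_mul]
        ring_nf)
      (fun u v v' => by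
        rw [← (summable_coag K u v).tsum_add (summable_coag K u v')]
        refine tsum_congr fun p => ?_
        rw [← add_smul, lp.coeFn_add, Pi.add_apply]
        ring_nf)
      (fun c u v => by
        rw [← (summable_coag K u v).tsum_const_smul]
        refine tsum_congr fun p => ?_
        rw [smul_smul, lp.coeFn_smul, Pi.smul_apply, smul_eq_mul]
        ring_nf))
    (3 * K.bound) (norm_tsum_coag_le K)

lemma coagBilin_apply (K : CoagulationKernel) (u v : EllOne) :
    coagBilin K u v = ∑' p : ℕ+ × ℕ+, (K p.1 p.2 * u p.1 * v p.2) • coagVector p.1 p.2 := rfl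

lemma norm_coagBilin_le (K : CoagulationKernel) (u v : EllOne) :
    ‖coagBilin K u v‖ ≤ 3 * K.bound * ‖u‖ * ‖v‖ :=
  norm_tsum_coag_le K u v

/-- Empty sites need no separate treatment in sums over sites: if a mass is 0, both sides vanish,
since K(0, ·) = 0. -/
lemma coagBilin_pointMass (K : CoagulationKernel) (i j : ℕ) :
    coagBilin K (pointMass i) (pointMass j) = K i j • coagVector i j := by
  rcases i with _ | i
  · simp [K.zero_left]
  rcases j with _ | j
  · simp [K.symm (i + 1) 0, K.zero_left]
  rw [coagBilin_apply, tsum_eq_single (i.succPNat, j.succPNat)]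
  · simp [pointMass_apply]
  · rintro ⟨a, b⟩ hab
    simp only [pointMass_apply]
    split_ifs with h1 h2
    · exact absurd (Prod.ext (PNat.eq h1.symm) (PNat.eq h2.symm)) hab
    all_goals simp

lemma coagVector_apply (i j : ℕ) (ℓ : ℕ+) : coagVector i j ℓ
    = (if i + j = ℓ then 1 else 0) - (if i = ℓ then 1 else 0) - (if j = ℓ then 1 else 0) := by
  rw [coagVector, lp.coeFn_sub, lp.coeFn_sub, Pi.sub_apply, Pi.sub_apply, pointMass_apply,
    pointMass_apply, pointMass_apply]

lemma summable_kernel_mul (K : CoagulationKernel) (u v : EllOne) :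
    Summable fun p : ℕ+ × ℕ+ => K p.1 p.2 * u p.1 * v p.2 := by
  refine Summable.of_norm_bounded ((summable_abs_mul_abs u v).mul_left K.bound) fun p => ?_
  rw [Real.norm_eq_abs, abs_mul, abs_mul, abs_of_nonneg (K.nonneg _ _), mul_assoc]
  exact mul_le_mul_of_nonneg_right (K.le_bound _ _) (by positivity)

lemma tsum_ite_fst_eq {a : ℕ+ × ℕ+ → ℝ} (ha : Summable a) (ℓ : ℕ+) :
    ∑' p : ℕ+ × ℕ+, a p * (if (p.1 : ℕ) = ℓ then 1 else 0) = ∑' j, a (ℓ, j) := by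
  have hs : Summable fun p : ℕ+ × ℕ+ => a p * (if (p.1 : ℕ) = ℓ then (1 : ℝ) else 0) := by
    refine Summable.of_norm_bounded ha.norm fun p => ?_
    split_ifs <;> simp
  rw [hs.tsum_prod, tsum_eq_single ℓ]
  · simp
  · intro b hb
    simp [hb]

lemma tsum_ite_snd_eq {a : ℕ+ × ℕ+ → ℝ} (ha : Summable a) (ℓ : ℕ+) :
    ∑' p : ℕ+ × ℕ+, a p * (if (p.2 : ℕ) = ℓ then 1 else 0) = ∑' i, a (i, ℓ) := by
  rw [← (Equiv.prodComm ℕ+ ℕ+).tsum_eq]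
  exact tsum_ite_fst_eq (a := fun p => a p.swap) ((Equiv.prodComm ℕ+ ℕ+).summable_iff.2 ha) ℓ

lemma tsum_ite_add_eq (a : ℕ+ × ℕ+ → ℝ) (ℓ : ℕ+) :
    ∑' p : ℕ+ × ℕ+, a p * (if (p.1 : ℕ) + p.2 = ℓ then 1 else 0)
      = ∑ i ∈ Finset.Ico 1 ℓ, a (i, ℓ - i) := by
  classical
  have hinj : Set.InjOn (fun i : ℕ+ => (i, ℓ - i)) (Finset.Ico 1 ℓ) := fun i _ j _ h => by
    simpa using congrArg Prod.fst h
  rw [tsum_eq_sum (s := (Finset.Ico 1 ℓ).image fun i => (i, ℓ - i)), Finset.sum_image hinj]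
  · refine Finset.sum_congr rfl fun i hi => ?_
    have := PNat.add_sub_of_lt (Finset.mem_Ico.1 hi).2
    rw [if_pos, mul_one]
    exact_mod_cast congrArg PNat.val this
  · rintro ⟨i, j⟩ h
    rw [if_neg, mul_zero]
    intro hij
    have hij' : i + j = ℓ := PNat.eq (by simpa using hij)
    apply h
    simp only [Finset.mem_image, Finset.mem_Ico, Prod.mk.injEq]
    have hlt : i < ℓ := hij' ▸ PNat.lt_add_right i j
    refine ⟨i, ⟨one_le, hlt⟩, rfl, ?_⟩
    have := PNat.add_sub_of_lt hlt
    rw [← hij'] at this ⊢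
    exact add_left_cancel this

/-- The three terms of `coagVector` give the gain and two losses; the losses agree by symmetry of K,
whence the factor 2. -/
lemma smoluchowskiOp_eq (K : CoagulationKernel) (u : EllOne) :
    smoluchowskiOp K u = coagBilin K u u := by
  apply lp.ext
  funext ℓ
  have hs := summable_kernel_mul K u u
  have hb : ∀ q : ℕ+ × ℕ+ → Prop, ∀ _ : DecidablePred q,
      Summable fun p : ℕ+ × ℕ+ => K p.1 p.2 * u p.1 * u p.2 * (if q p then 1 else 0) := by
    intro q _
    refine Summable.of_norm_bounded hs.norm fun p => ?_
    split_ifs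
    · rw [mul_one]
    · rw [mul_zero, norm_zero]
      exact norm_nonneg _
  have h1 : coagBilin K u u ℓ = ∑' p : ℕ+ × ℕ+, K p.1 p.2 * u p.1 * u p.2 *
      coagVector p.1 p.2 ℓ := by
    rw [← EllOne.coord_apply, coagBilin_apply, (EllOne.coord ℓ).map_tsum (summable_coag K u u)]
    exact tsum_congr fun p => by rw [map_smul, smul_eq_mul, EllOne.coord_apply]
  rw [h1]
  simp only [coagVector_apply, mul_sub]
  rw [((hb _ _).sub (hb _ _)).tsum_sub (hb _ _), (hb _ _).tsum_sub (hb _ _),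
    tsum_ite_add_eq (fun p => K p.1 p.2 * u p.1 * u p.2), tsum_ite_fst_eq hs, tsum_ite_snd_eq hs]
  show smoluchowskiCoord K u ℓ = _
  rw [smoluchowskiCoord, sub_sub, two_mul]
  congr 2
  refine tsum_congr fun i => ?_
  rw [K.symm ℓ i]
  ring

lemma norm_smoluchowskiOp_le (K : CoagulationKernel) {u : EllOne} (hu : u ∈ MPlus) :
    ‖smoluchowskiOp K u‖ ≤ 3 * K.bound := by
  rw [smoluchowskiOp_eq]
  refine (norm_coagBilin_le K u u).trans ?_
  have h := norm_le_one_of_mem hu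
  have := K.bound_nonneg
  calc 3 * K.bound * ‖u‖ * ‖u‖ ≤ 3 * K.bound * 1 * 1 := by gcongr
    _ = _ := by ring

/-- By bilinearity B(u,u) - B(v,v) = B(u-v,u) + B(v,u-v), where both norms in M₊ are at most 1. -/
lemma norm_smoluchowskiOp_sub_le (K : CoagulationKernel) {u v : EllOne} (hu : u ∈ MPlus)
    (hv : v ∈ MPlus) :
    ‖smoluchowskiOp K u - smoluchowskiOp K v‖ ≤ 6 * K.bound * ‖u - v‖ := by
  have h : smoluchowskiOp K u - smoluchowskiOp K v
      = coagBilin K (u - v) u + coagBilin K v (u - v) := by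
    simp only [smoluchowskiOp_eq, map_sub, _root_.sub_apply]
    abel
  have := K.bound_nonneg
  rw [h]
  calc _ ≤ 3 * K.bound * ‖u - v‖ * ‖u‖ + 3 * K.bound * ‖v‖ * ‖u - v‖ :=
        (norm_add_le _ _).trans (add_le_add (norm_coagBilin_le _ _ _) (norm_coagBilin_le _ _ _))
    _ ≤ 3 * K.bound * ‖u - v‖ * 1 + 3 * K.bound * 1 * ‖u - v‖ := by
        have := norm_le_one_of_mem hu
        have := norm_le_one_of_mem hv
        gcongr
    _ = _ := by ring

lemma continuous_smoluchowskiOp (K : CoagulationKernel) : Continuous (smoluchowskiOp K) := by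
  have : smoluchowskiOp K = fun u => coagBilin K u u := funext (smoluchowskiOp_eq K)
  rw [this]
  fun_prop

/-- `M₊` is invariant under an explicit Euler step of the Smoluchowski equation. -/
lemma add_smul_smoluchowskiOp_mem (K : CoagulationKernel) {u : EllOne} (hu : u ∈ MPlus) {h : ℝ}
    (h0 : 0 ≤ h) (h1 : 2 * K.bound * h ≤ 1) : u + h • smoluchowskiOp K u ∈ MPlus := by
  rw [mem_MPlus_iff]
  have hK : ∀ p : ℕ+ × ℕ+, 0 ≤ K p.1 p.2 * u p.1 * u p.2 := fun p =>
    mul_nonneg (mul_nonneg (K.nonneg _ _) (hu.1 _)) (hu.1 _)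
  constructor
  · intro ℓ
    rw [map_add, map_smul, smul_eq_mul, EllOne.coord_apply, EllOne.coord_apply]
    show 0 ≤ u ℓ + h * smoluchowskiCoord K u ℓ
    have hg : 0 ≤ ∑ i ∈ Finset.Ico 1 ℓ, K i (ℓ - i : ℕ+) * u i * u (ℓ - i) :=
      Finset.sum_nonneg fun i _ => hK (i, ℓ - i)
    have hl : ∑' i : ℕ+, K ℓ i * u ℓ * u i ≤ K.bound * u ℓ := by
      calc ∑' i : ℕ+, K ℓ i * u ℓ * u i ≤ ∑' i : ℕ+, K.bound * u ℓ * u i := by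
            refine Summable.tsum_le_tsum (fun i => ?_)
              ((summable_kernel_mul K u u).prod_factor ℓ) (u.summable_abs.of_abs.mul_left _)
            have := hu.1 i
            have := hu.1 ℓ
            have := K.le_bound ℓ i
            gcongr
        _ = K.bound * u ℓ * EllOne.total u := tsum_mul_left
        _ ≤ K.bound * u ℓ * 1 :=
            mul_le_mul_of_nonneg_left hu.2 (mul_nonneg K.bound_nonneg (hu.1 ℓ))
        _ = _ := mul_one _
    rw [smoluchowskiCoord]
    -- The loss at ℓ during the step is at most 2Ch u_ℓ, as the total of u is at most 1; it cannot
    -- exceed u_ℓ.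
    have h2 : 2 * K.bound * h * u ℓ ≤ 1 * u ℓ := mul_le_mul_of_nonneg_right h1 (hu.1 ℓ)
    have h3 := mul_nonneg h0 hg
    have h4 := mul_le_mul_of_nonneg_left hl h0
    nlinarith
  · rw [map_add, map_smul, smul_eq_mul, smoluchowskiOp_eq, coagBilin_apply,
      EllOne.total.map_tsum (summable_coag K u u)]
    -- Each coagulation turns two particles into one, so the total can only decrease.
    have : ∑' p : ℕ+ × ℕ+, EllOne.total ((K p.1 p.2 * u p.1 * u p.2) • coagVector p.1 p.2) ≤ 0 := by
      refine tsum_nonpos fun p => ?_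
      rw [map_smul, total_coagVector p.1.pos p.2.pos, smul_eq_mul]
      linarith [hK p]
    have h2 : EllOne.total u ≤ 1 := hu.2
    nlinarith

/-! ### The mild form of the Smoluchowski equation -/

/-- The rate at which the linear part is split off in the mild form of the equation. -/
def CoagulationKernel.rate (K : CoagulationKernel) : ℝ := 2 * K.bound + 1

lemma CoagulationKernel.rate_pos (K : CoagulationKernel) : 0 < K.rate := by
  have := K.bound_nonneg
  unfold CoagulationKernel.rate
  linarith

/-- The Euler step `u ↦ u + λ⁻¹ 𝒦 u`. -/
def eulerStep (K : CoagulationKernel) (u : EllOne) : EllOne := u + K.rate⁻¹ • smoluchowskiOp K u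

/-- The rate λ = 2C + 1 is above the threshold 2C for invariance; the extra 1 keeps λ invertible
when C = 0. -/
lemma eulerStep_mem (K : CoagulationKernel) {u : EllOne} (hu : u ∈ MPlus) :
    eulerStep K u ∈ MPlus := by
  refine add_smul_smoluchowskiOp_mem K hu (inv_nonneg.2 K.rate_pos.le) ?_
  rw [← div_eq_mul_inv, div_le_one K.rate_pos, CoagulationKernel.rate]
  linarith

lemma norm_eulerStep_sub_le (K : CoagulationKernel) {u v : EllOne} (hu : u ∈ MPlus)
    (hv : v ∈ MPlus) : ‖eulerStep K u - eulerStep K v‖ ≤ 4 * ‖u - v‖ := by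
  have h : eulerStep K u - eulerStep K v
      = (u - v) + K.rate⁻¹ • (smoluchowskiOp K u - smoluchowskiOp K v) := by
    rw [eulerStep, eulerStep, smul_sub]
    abel
  -- As 6C ≤ 3λ, the Lipschitz constant 1 + 6C/λ is at most 4.
  have h1 : K.rate⁻¹ * (6 * K.bound) ≤ 3 := by
    rw [inv_mul_le_iff₀ K.rate_pos, CoagulationKernel.rate]
    linarith
  rw [h]
  calc _ ≤ ‖u - v‖ + K.rate⁻¹ * (6 * K.bound * ‖u - v‖) := by
        refine (norm_add_le _ _).trans (add_le_add_right ?_ _)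
        rw [norm_smul, Real.norm_of_nonneg (inv_nonneg.2 K.rate_pos.le)]
        exact mul_le_mul_of_nonneg_left (norm_smoluchowskiOp_sub_le K hu hv)
          (inv_nonneg.2 K.rate_pos.le)
    _ ≤ 4 * ‖u - v‖ := by nlinarith [norm_nonneg (u - v)]

lemma continuous_eulerStep (K : CoagulationKernel) : Continuous (eulerStep K) :=
  continuous_id.add ((continuous_smoluchowskiOp K).fun_const_smul _)

/-- The mild map `w ↦ e^{-λt} (u₀ + ∫₀ᵗ λ e^{λs} (w + λ⁻¹ 𝒦 w)(s) ds)`. -/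
def mildMap (K : CoagulationKernel) (u₀ : EllOne) (w : ℝ → EllOne) (t : ℝ) : EllOne :=
  Real.exp (-(K.rate * t)) •
    (u₀ + ∫ s in (0 : ℝ)..t, (K.rate * Real.exp (K.rate * s)) • eulerStep K (w s))

lemma continuous_mildIntegrand (K : CoagulationKernel) {w : ℝ → EllOne} (hw : Continuous w) :
    Continuous fun s => (K.rate * Real.exp (K.rate * s)) • eulerStep K (w s) := by
  have h : Continuous fun s => K.rate * Real.exp (K.rate * s) := by fun_prop
  exact h.smul ((continuous_eulerStep K).comp hw)

/-- At a fixed point w of the mild map, λ(w + λ⁻¹𝒦w) - λw = 𝒦w, which is the Smoluchowski equation.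
-/
lemma hasDerivAt_mildMap (K : CoagulationKernel) (u₀ : EllOne) {w : ℝ → EllOne}
    (hw : Continuous w) (t : ℝ) :
    HasDerivAt (mildMap K u₀ w)
      (K.rate • eulerStep K (w t) - K.rate • mildMap K u₀ w t) t := by
  have hc := continuous_mildIntegrand K hw
  have h1 : HasDerivAt (fun t : ℝ => Real.exp (-(K.rate * t)))
      (Real.exp (-(K.rate * t)) * -K.rate) t := by
    have : HasDerivAt (fun t : ℝ => -(K.rate * t)) (-K.rate) t := by
      simpa using ((hasDerivAt_id t).const_mul K.rate).fun_neg
    exact this.exp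
  have h2 := (intervalIntegral.integral_hasDerivAt_right (hc.intervalIntegrable 0 t)
    (hc.stronglyMeasurableAtFilter _ _) hc.continuousAt).const_add u₀
  convert! h1.fun_smul h2 using 1
  rw [smul_smul, mul_left_comm, ← Real.exp_add, neg_add_cancel, Real.exp_zero, mul_one, mildMap,
    smul_smul, mul_neg, neg_smul, mul_comm K.rate, sub_eq_add_neg]

lemma mildMap_zero (K : CoagulationKernel) (u₀ : EllOne) (w : ℝ → EllOne) :
    mildMap K u₀ w 0 = u₀ := by
  simp [mildMap]

lemma integral_rate_mul_exp (K : CoagulationKernel) (t : ℝ) :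
    ∫ s in (0 : ℝ)..t, K.rate * Real.exp (K.rate * s) = Real.exp (K.rate * t) - 1 := by
  have h : ∀ s ∈ Set.uIcc 0 t, HasDerivAt (fun s : ℝ => Real.exp (K.rate * s))
      (K.rate * Real.exp (K.rate * s)) s := by
    intro s _
    have : HasDerivAt (fun t : ℝ => K.rate * t) K.rate s := by
      simpa using (hasDerivAt_id s).const_mul K.rate
    rw [mul_comm]
    exact this.exp
  rw [intervalIntegral.integral_eq_sub_of_hasDerivAt h
    (Continuous.intervalIntegrable (by fun_prop) _ _)]
  simp

/-- The weights e^{-λt} on u₀ and λe^{-λ(t-s)} ds on the Euler steps have total 1, so the value is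
an average of elements of M₊. Membership is tested on the coordinates and the total, continuous
linear functionals that commute with the integral. -/
lemma mildMap_mem (K : CoagulationKernel) {u₀ : EllOne} (hu₀ : u₀ ∈ MPlus) {w : ℝ → EllOne}
    (hw : Continuous w) (hwm : ∀ s, w s ∈ MPlus) {t : ℝ} (ht : 0 ≤ t) :
    mildMap K u₀ w t ∈ MPlus := by
  have hc := continuous_mildIntegrand K hw
  have hi := hc.intervalIntegrable (μ := volume) 0 t
  have hr := K.rate_pos
  rw [mem_MPlus_iff] at *
  have hcomm : ∀ L : EllOne →L[ℝ] ℝ, L (mildMap K u₀ w t) = Real.exp (-(K.rate * t)) *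
      (L u₀ + ∫ s in (0 : ℝ)..t, (K.rate * Real.exp (K.rate * s)) * L (eulerStep K (w s))) := by
    intro L
    rw [mildMap, map_smul, smul_eq_mul, map_add, ← L.intervalIntegral_comp_comm hi]
    simp only [map_smul, smul_eq_mul]
  constructor
  · intro ℓ
    rw [hcomm]
    refine mul_nonneg (Real.exp_nonneg _) (add_nonneg (hu₀.1 ℓ) ?_)
    refine intervalIntegral.integral_nonneg ht fun s _ => ?_
    exact mul_nonneg (by positivity) ((eulerStep_mem K (hwm s)).1 ℓ)
  · rw [hcomm]
    have h1 : ∫ s in (0 : ℝ)..t, (K.rate * Real.exp (K.rate * s)) *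
        EllOne.total (eulerStep K (w s)) ≤ Real.exp (K.rate * t) - 1 := by
      rw [← integral_rate_mul_exp]
      have hE : Continuous fun s => EllOne.total (eulerStep K (w s)) :=
        EllOne.total.continuous.comp ((continuous_eulerStep K).comp hw)
      refine intervalIntegral.integral_mono_on ht
        (Continuous.intervalIntegrable (by fun_prop) _ _)
        (Continuous.intervalIntegrable (by fun_prop) _ _) fun s _ => ?_
      exact mul_le_of_le_one_right (by positivity) (eulerStep_mem K (hwm s)).2
    calc _ ≤ Real.exp (-(K.rate * t)) * (1 + (Real.exp (K.rate * t) - 1)) := by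
          have := hu₀.2
          gcongr
      _ = 1 := by rw [add_sub_cancel, ← Real.exp_add, neg_add_cancel, Real.exp_zero]

/-- The bound `b` depends on time so that the estimate can be iterated: this is the source of the
factorial in `dist_iterate_mildPath_le`. The weight λe^{λ(s-t)} is at most λ. -/
lemma norm_mildMap_sub_le (K : CoagulationKernel) (u₀ : EllOne) {w w' : ℝ → EllOne}
    (hw : Continuous w) (hw' : Continuous w') (hwm : ∀ s, w s ∈ MPlus) (hwm' : ∀ s, w' s ∈ MPlus)
    {t : ℝ} (ht : 0 ≤ t) {b : ℝ → ℝ} (hb : Continuous b)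
    (hwb : ∀ s ∈ Set.Icc 0 t, ‖w s - w' s‖ ≤ b s) :
    ‖mildMap K u₀ w t - mildMap K u₀ w' t‖ ≤ ∫ s in (0 : ℝ)..t, 4 * K.rate * b s := by
  have hr := K.rate_pos
  have h : mildMap K u₀ w t - mildMap K u₀ w' t = ∫ s in (0 : ℝ)..t,
      (K.rate * Real.exp (K.rate * (s - t))) • (eulerStep K (w s) - eulerStep K (w' s)) := by
    rw [mildMap, mildMap, ← smul_sub, add_sub_add_left_eq_sub, ← intervalIntegral.integral_sub
      ((continuous_mildIntegrand K hw).intervalIntegrable _ _)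
      ((continuous_mildIntegrand K hw').intervalIntegrable _ _), ← intervalIntegral.integral_smul]
    congr 1
    funext s
    rw [← smul_sub, smul_smul, mul_left_comm, ← Real.exp_add]
    ring_nf
  rw [h]
  refine intervalIntegral.norm_integral_le_of_norm_le ht (Eventually.of_forall fun s hs => ?_)
    (Continuous.intervalIntegrable (by fun_prop) _ _)
  rw [norm_smul, Real.norm_of_nonneg (by positivity)]
  have h1 := norm_eulerStep_sub_le K (hwm s) (hwm' s)
  have h2 := hwb s ⟨hs.1.le, hs.2⟩
  have h3 : Real.exp (K.rate * (s - t)) ≤ 1 := by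
    rw [Real.exp_le_one_iff]
    exact mul_nonpos_of_nonneg_of_nonpos hr.le (by linarith [hs.2])
  calc _ ≤ K.rate * 1 * (4 * b s) := by
        gcongr
        exact h1.trans (by linarith)
    _ = _ := by ring

/-! ### Existence and uniqueness for the Smoluchowski equation -/

/-- The extension of a path on `[0,T]` to `ℝ` by constants. -/
def extendPath {T : ℝ} (hT : 0 ≤ T) (u : C(Set.Icc 0 T, MPlus)) (s : ℝ) : EllOne :=
  u (Set.projIcc 0 T hT s)

lemma continuous_extendPath {T : ℝ} (hT : 0 ≤ T) (u : C(Set.Icc 0 T, MPlus)) :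
    Continuous (extendPath hT u) :=
  continuous_subtype_val.comp (u.continuous.comp continuous_projIcc)

lemma extendPath_mem {T : ℝ} (hT : 0 ≤ T) (u : C(Set.Icc 0 T, MPlus)) (s : ℝ) :
    extendPath hT u s ∈ MPlus := (u _).2

lemma extendPath_coe {T : ℝ} (hT : 0 ≤ T) (u : C(Set.Icc 0 T, MPlus)) (s : Set.Icc 0 T) :
    extendPath hT u s = u s := by
  rw [extendPath, Set.projIcc_val]

/-- The mild map on `C([0,T]; M₊)`. -/
def mildPath (K : CoagulationKernel) {T : ℝ} (hT : 0 ≤ T) (u₀ : MPlus)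
    (u : C(Set.Icc 0 T, MPlus)) : C(Set.Icc 0 T, MPlus) where
  toFun t := ⟨mildMap K u₀ (extendPath hT u) t,
    mildMap_mem K u₀.2 (continuous_extendPath hT u) (extendPath_mem hT u) t.2.1⟩
  continuous_toFun := by
    refine Continuous.subtype_mk ?_ _
    have : Continuous (mildMap K u₀ (extendPath hT u)) := continuous_iff_continuousAt.2 fun t =>
      (hasDerivAt_mildMap K u₀ (continuous_extendPath hT u) t).continuousAt
    exact this.comp continuous_subtype_val

lemma dist_iterate_mildPath_le (K : CoagulationKernel) {T : ℝ} (hT : 0 ≤ T) (u₀ : MPlus)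
    (u v : C(Set.Icc 0 T, MPlus)) (k : ℕ) (t : Set.Icc 0 T) :
    dist ((mildPath K hT u₀)^[k] u t) ((mildPath K hT u₀)^[k] v t)
      ≤ dist u v * ((4 * K.rate * t) ^ k / k.factorial) := by
  induction k generalizing t with
  | zero => simpa using ContinuousMap.dist_apply_le_dist t
  | succ k ih =>
    rw [Function.iterate_succ_apply', Function.iterate_succ_apply', Subtype.dist_eq, dist_eq_norm]
    refine (norm_mildMap_sub_le K u₀ (continuous_extendPath hT _) (continuous_extendPath hT _)
      (extendPath_mem hT _) (extendPath_mem hT _) t.2.1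
      (b := fun s => dist u v * ((4 * K.rate * s) ^ k / k.factorial)) (by fun_prop)
      fun s hs => ?_).trans_eq ?_
    · have hs' : s ∈ Set.Icc 0 T := ⟨hs.1, hs.2.trans t.2.2⟩
      have := ih ⟨s, hs'⟩
      rw [Subtype.dist_eq, dist_eq_norm] at this
      simpa only [extendPath, Set.projIcc_of_mem hT hs'] using this
    · have : ∀ s : ℝ, 4 * K.rate * (dist u v * ((4 * K.rate * s) ^ k / k.factorial))
          = dist u v * (4 * K.rate) ^ (k + 1) / k.factorial * s ^ k := by
        intro s
        rw [mul_pow]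
        ring
      simp only [this]
      rw [intervalIntegral.integral_const_mul, integral_pow, Nat.factorial_succ]
      push_cast
      rw [mul_pow]
      field_simp
      ring

/-- Since (4λT)^k / k! tends to 0, some iterate is a contraction, whatever the size of T. The fixed
point of an iterate that contracts is fixed by the map itself. -/
lemma exists_isFixedPt_mildPath (K : CoagulationKernel) {T : ℝ} (hT : 0 ≤ T) (u₀ : MPlus) :
    ∃ u, Function.IsFixedPt (mildPath K hT u₀) u := by
  have : CompleteSpace MPlus := isClosed_MPlus.completeSpace_coe
  have : Nonempty C(Set.Icc 0 T, MPlus) := ⟨ContinuousMap.const _ u₀⟩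
  have hr := K.rate_pos
  obtain ⟨k, hk⟩ := ((FloorSemiring.tendsto_pow_div_factorial_atTop
    (4 * K.rate * T)).eventually_lt_const (show (0 : ℝ) < 1 / 2 by norm_num)).exists
  have hc : ContractingWith (1 / 2 : ℝ≥0) (mildPath K hT u₀)^[k] := by
    refine ⟨by rw [one_div]; exact inv_lt_one_of_one_lt₀ one_lt_two,
      LipschitzWith.of_dist_le_mul fun u v => ?_⟩
    rw [ContinuousMap.dist_le (by positivity)]
    intro t
    refine (dist_iterate_mildPath_le K hT u₀ u v k t).trans ?_
    rw [mul_comm]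
    refine mul_le_mul_of_nonneg_right ?_ dist_nonneg
    have ht := t.2
    calc (4 * K.rate * (t : ℝ)) ^ k / k.factorial ≤ (4 * K.rate * T) ^ k / k.factorial := by
          have := ht.1
          have := ht.2
          gcongr
      _ ≤ _ := by
          refine hk.le.trans ?_
          norm_num
  exact ⟨_, hc.isFixedPt_fixedPoint_iterate⟩

lemma isWeakSolution_of_isFixedPt (K : CoagulationKernel) {T : ℝ} (hT : 0 ≤ T) (u₀ : MPlus)
    {u : C(Set.Icc 0 T, MPlus)} (hu : Function.IsFixedPt (mildPath K hT u₀) u) :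
    IsWeakSolution K hT u ∧ u ⟨0, Set.left_mem_Icc.2 hT⟩ = u₀ := by
  have hval : ∀ t : Set.Icc 0 T, (u t : EllOne) = mildMap K u₀ (extendPath hT u) t := by
    intro t
    exact congrArg Subtype.val (DFunLike.congr_fun hu t).symm
  have h0 : (u ⟨0, Set.left_mem_Icc.2 hT⟩ : EllOne) = u₀ := by
    rw [hval]
    exact mildMap_zero _ _ _
  refine ⟨fun t => ?_, Subtype.ext h0⟩
  have hcont : Continuous fun s => smoluchowskiOp K (extendPath hT u s) :=
    (continuous_smoluchowskiOp K).comp (continuous_extendPath hT u)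
  have hd : ∀ s ∈ Set.uIcc 0 (t : ℝ), HasDerivAt (mildMap K u₀ (extendPath hT u))
      (smoluchowskiOp K (extendPath hT u s)) s := by
    intro s hs
    rw [Set.uIcc_of_le t.2.1] at hs
    have hs' : s ∈ Set.Icc 0 T := ⟨hs.1, hs.2.trans t.2.2⟩
    have h := hasDerivAt_mildMap K u₀ (continuous_extendPath hT u) s
    have hws : extendPath hT u s = mildMap K u₀ (extendPath hT u) s := by
      rw [← hval ⟨s, hs'⟩, ← extendPath_coe hT u ⟨s, hs'⟩]
    rw [← hws, eulerStep, smul_add, add_sub_cancel_left, smul_smul,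
      mul_inv_cancel₀ K.rate_pos.ne', one_smul] at h
    exact h
  have h := intervalIntegral.integral_eq_sub_of_hasDerivAt hd (hcont.intervalIntegrable _ _)
  rw [mildMap_zero, ← hval] at h
  rw [h0]
  exact eq_add_of_sub_eq' h.symm

/-- The integral equation in terms of the path extended by constants. -/
lemma IsWeakSolution.extendPath_eq {K : CoagulationKernel} {T : ℝ} {hT : 0 ≤ T}
    {u : C(Set.Icc 0 T, MPlus)} (hu : IsWeakSolution K hT u) {t : ℝ} (ht : t ∈ Set.Icc 0 T) :
    extendPath hT u t = extendPath hT u 0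
      + ∫ s in (0 : ℝ)..t, smoluchowskiOp K (extendPath hT u s) := by
  have h := hu ⟨t, ht⟩
  rw [← extendPath_coe hT u ⟨t, ht⟩, ← extendPath_coe hT u ⟨0, _⟩] at h
  exact h

lemma continuous_smoluchowskiOp_extendPath (K : CoagulationKernel) {T : ℝ} (hT : 0 ≤ T)
    (u : C(Set.Icc 0 T, MPlus)) : Continuous fun s => smoluchowskiOp K (extendPath hT u s) :=
  (continuous_smoluchowskiOp K).comp (continuous_extendPath hT u)

lemma IsWeakSolution.sub_eq {K : CoagulationKernel} {T : ℝ} {hT : 0 ≤ T}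
    {u : C(Set.Icc 0 T, MPlus)} (hu : IsWeakSolution K hT u) {s t : ℝ} (hs : s ∈ Set.Icc 0 T)
    (ht : t ∈ Set.Icc 0 T) :
    extendPath hT u t - extendPath hT u s
      = ∫ r in s..t, smoluchowskiOp K (extendPath hT u r) := by
  have hc := continuous_smoluchowskiOp_extendPath K hT u
  rw [hu.extendPath_eq ht, hu.extendPath_eq hs, add_sub_add_left_eq_sub,
    intervalIntegral.integral_interval_sub_left (hc.intervalIntegrable _ _)
      (hc.intervalIntegrable _ _)]

lemma IsWeakSolution.norm_sub_le {K : CoagulationKernel} {T : ℝ} {hT : 0 ≤ T}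
    {u : C(Set.Icc 0 T, MPlus)} (hu : IsWeakSolution K hT u) {s t : ℝ} (hs : s ∈ Set.Icc 0 T)
    (ht : t ∈ Set.Icc 0 T) :
    ‖extendPath hT u t - extendPath hT u s‖ ≤ 3 * K.bound * |t - s| := by
  rw [hu.sub_eq hs ht]
  exact intervalIntegral.norm_integral_le_of_norm_le_const fun r _ =>
    norm_smoluchowskiOp_le K (extendPath_mem hT u r)

/-- The local error of the explicit Euler scheme. -/
lemma IsWeakSolution.norm_euler_error_le {K : CoagulationKernel} {T : ℝ} {hT : 0 ≤ T}
    {u : C(Set.Icc 0 T, MPlus)} (hu : IsWeakSolution K hT u) {s h : ℝ} (hs : 0 ≤ s)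
    (hh : 0 ≤ h) (hsh : s + h ≤ T) :
    ‖extendPath hT u (s + h) - extendPath hT u s - h • smoluchowskiOp K (extendPath hT u s)‖
      ≤ 18 * K.bound ^ 2 * h ^ 2 := by
  have hc := continuous_smoluchowskiOp_extendPath K hT u
  have hK := K.bound_nonneg
  have hsI : s ∈ Set.Icc 0 T := ⟨hs, by linarith⟩
  have h1 : extendPath hT u (s + h) - extendPath hT u s
      - h • smoluchowskiOp K (extendPath hT u s)
      = ∫ r in s..(s + h), (smoluchowskiOp K (extendPath hT u r)
          - smoluchowskiOp K (extendPath hT u s)) := by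
    rw [hu.sub_eq hsI ⟨by linarith, hsh⟩, intervalIntegral.integral_sub
      (hc.intervalIntegrable _ _) (continuous_const.intervalIntegrable _ _),
      intervalIntegral.integral_const, add_sub_cancel_left]
  rw [h1]
  have := intervalIntegral.norm_integral_le_of_norm_le_const (a := s) (b := s + h)
    -- Lipschitz constant 6C of 𝒦, times the displacement of u, which has speed at most 3C.
    (C := 6 * K.bound * (3 * K.bound * h))
    (f := fun r => smoluchowskiOp K (extendPath hT u r) - smoluchowskiOp K (extendPath hT u s))
    fun r hr => by
      rw [Set.uIoc_of_le (by linarith)] at hr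
      refine (norm_smoluchowskiOp_sub_le K (extendPath_mem hT u r)
        (extendPath_mem hT u s)).trans ?_
      refine mul_le_mul_of_nonneg_left ?_ (by positivity)
      refine (hu.norm_sub_le hsI ⟨by linarith [hr.1], by linarith [hr.2]⟩).trans ?_
      refine mul_le_mul_of_nonneg_left ?_ (by positivity)
      rw [abs_of_pos (by linarith [hr.1])]
      linarith [hr.2]
  refine this.trans_eq ?_
  rw [add_sub_cancel_left, abs_of_nonneg hh]
  ring

/-- Grönwall's inequality, in the version for trajectories confined to a set: the Lipschitz constant
6C is available on M₊ only. -/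
lemma IsWeakSolution.unique {K : CoagulationKernel} {T : ℝ} {hT : 0 ≤ T}
    {u v : C(Set.Icc 0 T, MPlus)} (hu : IsWeakSolution K hT u) (hv : IsWeakSolution K hT v)
    (h0 : (u ⟨0, Set.left_mem_Icc.2 hT⟩ : EllOne) = v ⟨0, Set.left_mem_Icc.2 hT⟩) : u = v := by
  have hderiv : ∀ {w : C(Set.Icc 0 T, MPlus)}, IsWeakSolution K hT w → ∀ t ∈ Set.Ico 0 T,
      HasDerivWithinAt (extendPath hT w) (smoluchowskiOp K (extendPath hT w t))
        (Set.Ici t) t := by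
    intro w hw t ht
    have hc := continuous_smoluchowskiOp_extendPath K hT w
    have h := ((intervalIntegral.integral_hasDerivAt_right (hc.intervalIntegrable 0 t)
      (hc.stronglyMeasurableAtFilter _ _) hc.continuousAt).const_add
      (extendPath hT w 0)).hasDerivWithinAt (s := Set.Ici t)
    refine h.congr_of_eventuallyEq ?_ (hw.extendPath_eq ⟨ht.1, ht.2.le⟩)
    filter_upwards [Icc_mem_nhdsGE ht.2] with s hs
    exact hw.extendPath_eq ⟨ht.1.trans hs.1, hs.2⟩
  have hK := K.bound_nonneg
  have hL : ∀ t ∈ Set.Ico 0 T, LipschitzOnWith (Real.toNNReal (6 * K.bound))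
      ((fun _ : ℝ => smoluchowskiOp K) t) ((fun _ : ℝ => MPlus) t) := by
    intro t _
    refine LipschitzOnWith.of_dist_le_mul fun x hx y hy => ?_
    rw [dist_eq_norm, dist_eq_norm, Real.coe_toNNReal _ (by positivity)]
    exact norm_smoluchowskiOp_sub_le K hx hy
  have key := dist_le_of_trajectories_ODE_of_mem (δ := 0) hL
    (continuous_extendPath hT u).continuousOn (hderiv hu) (fun t _ => extendPath_mem hT u t)
    (continuous_extendPath hT v).continuousOn (hderiv hv) (fun t _ => extendPath_mem hT v t)
    (by
      rw [← extendPath_coe hT u, ← extendPath_coe hT v] at h0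
      exact (dist_eq_zero.2 h0).le)
  ext1 t
  apply Subtype.ext
  have := key t t.2
  rw [zero_mul, extendPath_coe, extendPath_coe] at this
  exact dist_le_zero.1 this

/-! ### The effect of a coagulation event -/

/-- Only the sites x and y change, to the masses 0 and η_x + η_y. Taking φ to be the mass gives
conservation of mass; taking `pointMass` gives the jump of the empirical density. -/
lemma sum_merge_sub {n : ℕ} {A : Type*} [AddCommGroup A] (φ : ℕ → A) (η : Config n)
    {x y : Fin n} (hxy : x ≠ y) :
    ∑ z, φ (η.merge x y z) - ∑ z, φ (η z) = φ 0 + φ (η x + η y) - φ (η x) - φ (η y) := by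
  rw [← Finset.sum_sub_distrib, ← Finset.sum_subset (Finset.subset_univ {x, y}),
    Finset.sum_pair hxy]
  · simp only [Config.merge, if_true, if_neg hxy.symm, add_comm (η y)]
    abel
  · intro z _ hz
    simp only [Finset.mem_insert, Finset.mem_singleton, not_or] at hz
    simp [Config.merge, hz.1, hz.2]

lemma sum_merge {n : ℕ} (η : Config n) {x y : Fin n} (hxy : x ≠ y) :
    ∑ z, η.merge x y z = ∑ z, η z := by
  have h := sum_merge_sub (fun m => (m : ℤ)) η hxy
  push_cast at h
  zify
  linarith

lemma empiricalDensity_merge {n : ℕ} (η : Config n) {x y : Fin n} (hxy : x ≠ y) :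
    (empiricalDensity (η.merge x y) : EllOne)
      = empiricalDensity η + (1 / (n : ℝ)) • coagVector (η x) (η y) := by
  have h := sum_merge_sub pointMass η hxy
  rw [pointMass_zero, zero_add] at h
  rw [empiricalDensity_eq, empiricalDensity_eq, ← smul_add, coagVector, ← h,
    add_sub_cancel]

/-- The density `N_ℓ(η) / n` of particles of mass `ℓ`. -/
def density {n : ℕ} (ℓ : ℕ+) (η : Config n) : ℝ := (empiricalDensity η : EllOne) ℓ

lemma density_nonneg {n : ℕ} (ℓ : ℕ+) (η : Config n) : 0 ≤ density ℓ η :=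
  (empiricalDensity η).2.1 ℓ

lemma density_le_one {n : ℕ} (ℓ : ℕ+) (η : Config n) : density ℓ η ≤ 1 :=
  (le_abs_self _).trans ((EllOne.abs_apply_le _ ℓ).trans
    (norm_le_one_of_mem (empiricalDensity η).2))

lemma abs_density_le_one {n : ℕ} (ℓ : ℕ+) (η : Config n) : |density ℓ η| ≤ 1 := by
  rw [abs_of_nonneg (density_nonneg ℓ η)]
  exact density_le_one ℓ η

lemma density_merge_sub {n : ℕ} (ℓ : ℕ+) (η : Config n) {x y : Fin n} (hxy : x ≠ y) :
    density ℓ (η.merge x y) - density ℓ η = 1 / (n : ℝ) * coagVector (η x) (η y) ℓ := by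
  rw [density, density, empiricalDensity_merge η hxy, lp.coeFn_add, Pi.add_apply, lp.coeFn_smul,
    Pi.smul_apply, smul_eq_mul, add_sub_cancel_left]

lemma abs_coagVector_apply_le (i j : ℕ) (ℓ : ℕ+) : |coagVector i j ℓ| ≤ 3 :=
  (EllOne.abs_apply_le _ ℓ).trans (norm_coagVector_le i j)

/-! ### The generator on densities -/

lemma smoluchowskiOp_empiricalDensity (K : CoagulationKernel) {n : ℕ} (η : Config n) :
    smoluchowskiOp K (empiricalDensity η) = (1 / (n : ℝ)) • (1 / (n : ℝ)) •
      ∑ x, ∑ y, K (η x) (η y) • coagVector (η x) (η y) := by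
  rw [smoluchowskiOp_eq, empiricalDensity_eq]
  simp only [map_smul, map_sum, _root_.smul_apply, _root_.sum_apply, coagBilin_pointMass]
  rw [← Finset.smul_sum, Finset.sum_comm]

/-- The generator omits the pairs x = y that the bilinear operator includes. These are n terms of
size at most 3C, with the prefactor 1/n². -/
lemma abs_generator_density_sub_le (K : CoagulationKernel) {n : ℕ} (hn : 0 < n) (ℓ : ℕ+)
    (η : Config n) :
    |generator K n (density ℓ) η - smoluchowskiOp K (empiricalDensity η) ℓ|
      ≤ 3 * K.bound / n := by
  have hK := K.bound_nonneg
  have hn' : (0 : ℝ) < n := by exact_mod_cast hn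
  have h1 : generator K n (density ℓ) η = 1 / (n : ℝ) * (1 / (n : ℝ) *
      ∑ x, ∑ y ∈ Finset.univ.erase x, K (η x) (η y) * coagVector (η x) (η y) ℓ) := by
    rw [generator]
    congr 1
    rw [Finset.mul_sum]
    refine Finset.sum_congr rfl fun x _ => ?_
    rw [Finset.mul_sum]
    refine Finset.sum_congr rfl fun y hy => ?_
    rw [density_merge_sub ℓ η (Finset.ne_of_mem_erase hy).symm]
    ring
  have h2 : smoluchowskiOp K (empiricalDensity η) ℓ = 1 / (n : ℝ) * (1 / (n : ℝ) *
      ∑ x, ∑ y, K (η x) (η y) * coagVector (η x) (η y) ℓ) := by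
    rw [← EllOne.coord_apply, smoluchowskiOp_empiricalDensity]
    simp only [map_smul, map_sum, smul_eq_mul, EllOne.coord_apply]
  have h3 : ∀ x, ∑ y, K (η x) (η y) * coagVector (η x) (η y) ℓ
      = ∑ y ∈ Finset.univ.erase x, K (η x) (η y) * coagVector (η x) (η y) ℓ
        + K (η x) (η x) * coagVector (η x) (η x) ℓ := fun x =>
    (Finset.sum_erase_add _ _ (Finset.mem_univ x)).symm
  rw [h1, h2, Finset.sum_congr rfl fun x _ => h3 x, Finset.sum_add_distrib, ← mul_sub, ← mul_sub,
    sub_add_cancel_left, abs_mul, abs_mul, abs_neg, abs_of_nonneg (by positivity : 0 ≤ 1 / (n : ℝ))]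
  have h4 : |∑ x, K (η x) (η x) * coagVector (η x) (η x) ℓ| ≤ n * (K.bound * 3) := by
    refine (Finset.abs_sum_le_sum_abs _ _).trans
      ((Finset.sum_le_card_nsmul _ _ (K.bound * 3) fun x _ => ?_).trans_eq (by simp))
    rw [abs_mul, abs_of_nonneg (K.nonneg _ _)]
    exact mul_le_mul (K.le_bound _ _) (abs_coagVector_apply_le _ _ _) (abs_nonneg _) hK
  calc _ ≤ 1 / (n : ℝ) * (1 / n * (n * (K.bound * 3))) := by gcongr
    _ = _ := by field_simp

/-- The carré du champ `L f² - 2 f L f`. -/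
lemma generator_sq_sub (K : CoagulationKernel) (n : ℕ) (f : Config n → ℝ) (η : Config n) :
    generator K n (fun ζ => f ζ ^ 2) η - 2 * f η * generator K n f η
      = (1 / (n : ℝ)) * ∑ x : Fin n, ∑ y ∈ Finset.univ.erase x,
        K (η x) (η y) * (f (η.merge x y) - f η) ^ 2 := by
  rw [generator, generator, mul_left_comm, ← mul_sub, Finset.mul_sum, ← Finset.sum_sub_distrib]
  congr 1
  refine Finset.sum_congr rfl fun x _ => ?_
  rw [Finset.mul_sum, ← Finset.sum_sub_distrib]
  refine Finset.sum_congr rfl fun y _ => ?_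
  ring

lemma sum_sum_erase_le {n : ℕ} {a : Fin n → Fin n → ℝ} {b : ℝ} (hb : 0 ≤ b)
    (h : ∀ x y, x ≠ y → a x y ≤ b) :
    ∑ x : Fin n, ∑ y ∈ Finset.univ.erase x, a x y ≤ n * (n * b) := by
  calc _ ≤ ∑ x : Fin n, ∑ y ∈ Finset.univ.erase x, b :=
        Finset.sum_le_sum fun x _ => Finset.sum_le_sum fun y hy =>
          h x y (Finset.ne_of_mem_erase hy).symm
    _ ≤ ∑ x : Fin n, ∑ y : Fin n, b :=
        Finset.sum_le_sum fun x _ => Finset.sum_le_sum_of_subset_of_nonneg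
          (Finset.erase_subset _ _) fun _ _ _ => hb
    _ = _ := by simp

/-- The total jump rate is at most Cn, and a jump changes a density by at most 3/n. -/
lemma generator_density_sq_sub_le (K : CoagulationKernel) {n : ℕ} (hn : 0 < n) (ℓ : ℕ+)
    (η : Config n) :
    generator K n (fun ζ => density ℓ ζ ^ 2) η - 2 * density ℓ η * generator K n (density ℓ) η
      ≤ 9 * K.bound / n := by
  have hK := K.bound_nonneg
  have hn' : (0 : ℝ) < n := by exact_mod_cast hn
  rw [generator_sq_sub]
  calc _ ≤ 1 / (n : ℝ) * (n * (n * (K.bound * (1 / (n : ℝ) * 3) ^ 2))) := by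
        refine mul_le_mul_of_nonneg_left (sum_sum_erase_le (by positivity) fun x y hxy => ?_)
          (by positivity)
        rw [density_merge_sub ℓ η hxy]
        refine mul_le_mul (K.le_bound _ _) ?_ (sq_nonneg _) hK
        rw [mul_pow, mul_pow]
        refine mul_le_mul_of_nonneg_left ?_ (by positivity)
        rw [sq_le_sq, abs_of_pos (by norm_num : (0 : ℝ) < 3)]
        exact abs_coagVector_apply_le _ _ _
    _ = _ := by
        field_simp
        ring

/-! ### The semigroup for small times -/

lemma abs_generator_le (K : CoagulationKernel) {n : ℕ} {f : Config n → ℝ} {M : ℝ}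
    (hf : ∀ η, |f η| ≤ M) (η : Config n) : |generator K n f η| ≤ 2 * K.bound * n * M := by
  have hK := K.bound_nonneg
  have hM : 0 ≤ M := (abs_nonneg _).trans (hf η)
  rw [generator, abs_mul, abs_of_nonneg (by positivity : 0 ≤ 1 / (n : ℝ))]
  calc _ ≤ 1 / (n : ℝ) * (n * (n * (K.bound * (2 * M)))) := by
        refine mul_le_mul_of_nonneg_left ?_ (by positivity)
        refine (Finset.abs_sum_le_sum_abs _ _).trans ((Finset.sum_le_sum fun x _ =>
          Finset.abs_sum_le_sum_abs _ _).trans (sum_sum_erase_le (by positivity) fun x y _ => ?_))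
        rw [abs_mul, abs_of_nonneg (K.nonneg _ _)]
        refine mul_le_mul (K.le_bound _ _) ?_ (abs_nonneg _) hK
        have h1 := hf (η.merge x y)
        have h2 := hf η
        rw [abs_le] at *
        constructor <;> linarith [h1.1, h1.2, h2.1, h2.2]
    _ ≤ _ := by
        rcases Nat.eq_zero_or_pos n with rfl | hn
        · simp
        · have : (0 : ℝ) < n := by exact_mod_cast hn
          refine le_of_eq ?_
          field_simp

lemma abs_iterate_generator_le (K : CoagulationKernel) {n : ℕ} {f : Config n → ℝ} {M : ℝ}
    (hf : ∀ η, |f η| ≤ M) (k : ℕ) (η : Config n) :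
    |(generator K n)^[k] f η| ≤ (2 * K.bound * n) ^ k * M := by
  induction k generalizing η with
  | zero => simpa using hf η
  | succ k ih =>
    rw [Function.iterate_succ_apply']
    refine (abs_generator_le K ih η).trans_eq ?_
    ring

/-- First-order expansion of the transition semigroup. -/
lemma abs_transitionSemigroup_sub_le (K : CoagulationKernel) {n : ℕ} {f : Config n → ℝ} {M : ℝ}
    (hf : ∀ η, |f η| ≤ M) {h : ℝ≥0} (h1 : h ≤ 1) (η : Config n) :
    |transitionSemigroup K n h f η - f η - h * generator K n f η|
      ≤ (2 * K.bound * n) ^ 2 * Real.exp (2 * K.bound * n) * M * (h : ℝ) ^ 2 := by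
  have hK := K.bound_nonneg
  have hM : 0 ≤ M := (abs_nonneg _).trans (hf η)
  set R := 2 * K.bound * n with hR
  have hR0 : 0 ≤ R := by positivity
  have hexp : HasSum (fun k : ℕ => (h * R) ^ k / (k.factorial : ℝ)) (Real.exp (h * R)) := by
    rw [Real.exp_eq_exp_ℝ]
    exact NormedSpace.expSeries_div_hasSum_exp _
  set a : ℕ → ℝ := fun k => (h : ℝ) ^ k / (k.factorial : ℝ) * ((generator K n)^[k] f) η with ha
  have hsum : Summable a := by
    refine Summable.of_norm_bounded (hexp.summable.mul_left M) fun k => ?_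
    rw [ha, Real.norm_eq_abs, abs_mul, abs_of_nonneg (by positivity)]
    calc _ ≤ (h : ℝ) ^ k / (k.factorial : ℝ) * (R ^ k * M) := by
          gcongr
          exact abs_iterate_generator_le K hf k η
      _ = _ := by
          rw [mul_pow]
          ring
  -- Replacing (k+2)! by k! lets h² R² factor out and leaves an exponential series.
  have htail : ∀ k, ‖a (k + 2)‖ ≤ R ^ 2 * M * (h : ℝ) ^ 2 * ((h * R) ^ k / (k.factorial : ℝ)) := by
    intro k
    rw [ha, Real.norm_eq_abs, abs_mul, abs_of_nonneg (by positivity)]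
    calc _ ≤ (h : ℝ) ^ (k + 2) / (k.factorial : ℝ) * (R ^ (k + 2) * M) := by
          gcongr
          · exact Nat.le_add_right k 2
          · exact abs_iterate_generator_le K hf _ η
      _ = _ := by
          rw [mul_pow]
          ring
  have hsplit := hsum.sum_add_tsum_nat_add 2
  have heq : transitionSemigroup K n h f η - f η - h * generator K n f η
      = ∑' k, a (k + 2) := by
    have : transitionSemigroup K n h f η = ∑' k, a k := rfl
    rw [this, ← hsplit, Finset.sum_range_succ, Finset.sum_range_one]
    simp only [ha, pow_zero, Nat.factorial_zero, Nat.cast_one, div_one, Function.iterate_zero, id,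
      one_mul, pow_one, Nat.factorial_one, Function.iterate_one]
    ring
  rw [heq]
  refine (tsum_of_norm_bounded (hexp.mul_left _) htail).trans ?_
  have h2 : Real.exp (h * R) ≤ Real.exp R :=
    Real.exp_le_exp.2 (mul_le_of_le_one_left hR0 (by exact_mod_cast h1))
  calc _ ≤ R ^ 2 * M * (h : ℝ) ^ 2 * Real.exp R := by gcongr
    _ = _ := by ring

/-! ### Absorbing sets and reachable configurations -/

/-- A set of configurations that the chain cannot leave. -/
def IsAbsorbing (K : CoagulationKernel) {n : ℕ} (A : Set (Config n)) : Prop :=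
  ∀ η ∈ A, ∀ x y, x ≠ y → K (η x) (η y) ≠ 0 → η.merge x y ∈ A

/-- Jumps of positive rate stay in A, so every power of the generator applied to `f` vanishes on A,
and so does the exponential series. -/
lemma transitionSemigroup_eq_zero {K : CoagulationKernel} {n : ℕ} {A : Set (Config n)}
    (hA : IsAbsorbing K A) {f : Config n → ℝ} (hf : ∀ η ∈ A, f η = 0) (t : ℝ≥0) {η : Config n}
    (hη : η ∈ A) : transitionSemigroup K n t f η = 0 := by
  have h : ∀ k, ∀ η ∈ A, (generator K n)^[k] f η = 0 := by
    intro k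
    induction k with
    | zero => exact hf
    | succ k ih =>
      intro η hη
      rw [Function.iterate_succ_apply', generator]
      refine mul_eq_zero_of_right _ (Finset.sum_eq_zero fun x _ => Finset.sum_eq_zero
        fun y hy => ?_)
      by_cases hK : K (η x) (η y) = 0
      · rw [hK, zero_mul]
      · rw [ih η hη, ih _ (hA η hη x y (Finset.ne_of_mem_erase hy).symm hK), sub_zero, mul_zero]
  simp [transitionSemigroup, h _ η hη]

/-- The configurations that may be reached from `η`: coagulation conserves mass, and controls
the variation of the empirical density by the loss of particles. -/
def reachable {n : ℕ} (η : Config n) : Set (Config n) :=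
  {ζ | ∑ x, ζ x = ∑ x, η x ∧
    ‖(empiricalDensity ζ - empiricalDensity η : EllOne)‖
      ≤ 3 * (EllOne.total (empiricalDensity η) - EllOne.total (empiricalDensity ζ))}

lemma self_mem_reachable {n : ℕ} (η : Config n) : η ∈ reachable η := by
  simp [reachable]

/-- A positive rate forces both masses to be positive. The coagulation then lowers the total by
exactly 1/n and moves the density by at most 3/n, so the inequality defining `reachable` persists.
-/
lemma isAbsorbing_reachable (K : CoagulationKernel) {n : ℕ} (η : Config n) :
    IsAbsorbing K (reachable η) := by
  rintro ζ ⟨h1, h2⟩ x y hxy hK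
  obtain ⟨hx, hy⟩ := K.pos_of_ne_zero hK
  refine ⟨(sum_merge ζ hxy).trans h1, ?_⟩
  rw [empiricalDensity_merge ζ hxy, map_add, map_smul, total_coagVector hx hy, smul_eq_mul]
  have h3 : ‖(1 / (n : ℝ)) • coagVector (ζ x) (ζ y)‖ ≤ 1 / (n : ℝ) * 3 := by
    rw [norm_smul, Real.norm_of_nonneg (by positivity)]
    exact mul_le_mul_of_nonneg_left (norm_coagVector_le _ _) (by positivity)
  have h4 := norm_add_le ((empiricalDensity ζ : EllOne) - empiricalDensity η)
    ((1 / (n : ℝ)) • coagVector (ζ x) (ζ y))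
  rw [add_sub_right_comm]
  linarith

/-- Markov's inequality for the masses: a particle heavier than L counts at most η_x / L, and the
masses add up to n. -/
lemma total_empiricalDensity_sub_sum_le {n : ℕ} (η : Config n) (hη : ∑ x, η x = n) (L : ℕ+) :
    EllOne.total (empiricalDensity η)
      - ∑ ℓ ∈ Finset.Icc 1 L, (empiricalDensity η : EllOne) ℓ ≤ 1 / (L : ℝ) := by
  have hL : (0 : ℝ) < L := by exact_mod_cast L.pos
  have h1 : ∀ m : ℕ, EllOne.total (pointMass m) - ∑ ℓ ∈ Finset.Icc 1 L, pointMass m ℓ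
      ≤ m / (L : ℝ) := by
    intro m
    rcases Nat.eq_zero_or_pos m with rfl | hm
    · simp
    rw [total_pointMass hm]
    by_cases hmL : m ≤ L
    · have : ∑ ℓ ∈ Finset.Icc 1 L, pointMass m ℓ = 1 := by
        obtain ⟨ℓ, rfl⟩ : ∃ ℓ : ℕ+, (ℓ : ℕ) = m := ⟨⟨m, hm⟩, rfl⟩
        rw [Finset.sum_eq_single ℓ]
        · simp [pointMass_apply]
        · intro k _ hk
          rw [pointMass_apply, if_neg]
          exact fun h => hk (PNat.eq h.symm)
        · intro h
          exact absurd (Finset.mem_Icc.2 ⟨one_le, by exact_mod_cast hmL⟩) h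
      rw [this, sub_self]
      positivity
    · have h2 : 0 ≤ ∑ ℓ ∈ Finset.Icc 1 L, pointMass m ℓ :=
        Finset.sum_nonneg fun ℓ _ => (pointMass_mem m).1 ℓ
      have h3 : 1 ≤ (m : ℝ) / L := by
        rw [one_le_div hL]
        exact_mod_cast (not_le.1 hmL).le
      linarith
  have h2 : EllOne.total (empiricalDensity η)
      - ∑ ℓ ∈ Finset.Icc 1 L, (empiricalDensity η : EllOne) ℓ
      = 1 / (n : ℝ) * ∑ x, (EllOne.total (pointMass (η x))
        - ∑ ℓ ∈ Finset.Icc 1 L, pointMass (η x) ℓ) := by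
    simp only [← EllOne.coord_apply]
    rw [empiricalDensity_eq, Finset.sum_sub_distrib, mul_sub, Finset.sum_comm, map_smul, map_sum,
      smul_eq_mul, Finset.mul_sum (Finset.Icc 1 L)]
    simp only [map_smul, map_sum, smul_eq_mul]
  rw [h2]
  calc _ ≤ 1 / (n : ℝ) * ∑ x, (η x : ℝ) / L :=
        mul_le_mul_of_nonneg_left (Finset.sum_le_sum fun x _ => h1 (η x)) (by positivity)
    _ = (1 / (n : ℝ) * n) * (1 / L) := by
        rw [← Finset.sum_div, ← Nat.cast_sum, hη]
        ring
    -- An inequality only, because (1/n)·n is 0 when n = 0.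
    _ ≤ 1 * (1 / L) := by
        refine mul_le_mul_of_nonneg_right ?_ (by positivity)
        rw [one_div]
        exact inv_mul_le_one
    _ = _ := one_mul _

/-! ### Measurability in the past and right-continuous paths -/

lemma measurable_pastSigmaAlgebra {Ω E : Type*} [MeasurableSpace E] (Y : ℝ≥0 → Ω → E) {r s : ℝ≥0}
    (h : r ≤ s) : Measurable[pastSigmaAlgebra Y s] (Y r) := by
  have h1 : MeasurableSpace.comap (Y r) inferInstance ≤ pastSigmaAlgebra Y s :=
    le_iSup (fun r : Set.Iic s => MeasurableSpace.comap (Y r) inferInstance) ⟨r, h⟩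
  exact (comap_measurable (Y r)).mono h1 le_rfl

lemma stronglyMeasurable_pastSigmaAlgebra {n : ℕ} {Ω : Type*} (X : ℝ≥0 → Ω → Config n) {r s : ℝ≥0}
    (h : r ≤ s) (f : Config n → ℝ) :
    StronglyMeasurable[pastSigmaAlgebra X s] fun ω => f (X r ω) := by
  have : Measurable[pastSigmaAlgebra X s] fun ω => f (X r ω) :=
    (Measurable.of_discrete (f := f)).comp (measurable_pastSigmaAlgebra X h)
  exact this.stronglyMeasurable

/-- The state space is discrete, so a right-continuous path is constant on a short interval to the
right of `s`. Almost sure statements thus pass from a countable dense set to all times. -/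
lemma exists_mem_dense_eq {n : ℕ} {D : Set ℝ≥0} (hD : Dense D) {x : ℝ≥0 → Config n} (hx : IsCadlag x)
    {s b : ℝ≥0} (hb : s < b) : ∃ d ∈ D, s < d ∧ d < b ∧ x d = x s := by
  have h1 : ∀ᶠ r in 𝓝[≥] s, x r = x s :=
    (hx s).1 (mem_nhds_discrete.2 rfl : {x s} ∈ 𝓝 (x s))
  obtain ⟨c, hc, hsub⟩ := mem_nhdsGE_iff_exists_Ico_subset.1 h1
  obtain ⟨d, hd, h2⟩ := hD.exists_between (lt_min hc hb)
  exact ⟨d, hd, h2.1, h2.2.trans_le (min_le_right _ _),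
    hsub ⟨h2.1.le, h2.2.trans_le (min_le_left _ _)⟩⟩

/-! ### Fluctuations of the chain -/

/-- The constant in the first-order expansion of the semigroup. -/
def expansionConst (K : CoagulationKernel) (n : ℕ) : ℝ :=
  (2 * K.bound * n) ^ 2 * Real.exp (2 * K.bound * n)

lemma expansionConst_nonneg (K : CoagulationKernel) (n : ℕ) : 0 ≤ expansionConst K n := by
  unfold expansionConst
  positivity

lemma abs_transitionSemigroup_sub_le' (K : CoagulationKernel) {n : ℕ} {f : Config n → ℝ}
    (hf : ∀ η, |f η| ≤ 1) {h : ℝ≥0} (h1 : h ≤ 1) (η : Config n) :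
    |transitionSemigroup K n h f η - f η - h * generator K n f η|
      ≤ expansionConst K n * (h : ℝ) ^ 2 := by
  simpa [expansionConst] using abs_transitionSemigroup_sub_le K hf h1 η

/-- Only a finite bound is needed, for integrability; contractivity of the semigroup is not used. -/
lemma exists_abs_transitionSemigroup_le (K : CoagulationKernel) {n : ℕ} {f : Config n → ℝ}
    (hf : ∀ η, |f η| ≤ 1) {h : ℝ≥0} (h1 : h ≤ 1) :
    ∃ c, ∀ η, |transitionSemigroup K n h f η| ≤ c := by
  refine ⟨1 + h * (2 * K.bound * n * 1) + expansionConst K n * (h : ℝ) ^ 2, fun η => ?_⟩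
  have h2 := abs_transitionSemigroup_sub_le' K hf h1 η
  have h3 := hf η
  have h4 : |h * generator K n f η| ≤ h * (2 * K.bound * n * 1) := by
    rw [abs_mul, abs_of_nonneg h.coe_nonneg]
    exact mul_le_mul_of_nonneg_left (abs_generator_le K hf η) h.coe_nonneg
  rw [abs_le] at *
  constructor <;> linarith [h2.1, h2.2, h3.1, h3.2, h4.1, h4.2]

/-- The fluctuation `f(X_{s+h}) - E[f(X_{s+h}) | X_s]`. -/
def fluctuation {n : ℕ} {Ω : Type*} (K : CoagulationKernel) (X : ℝ≥0 → Ω → Config n) (h : ℝ≥0) (f : Config n → ℝ)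
    (s : ℝ≥0) (ω : Ω) : ℝ :=
  f (X (s + h) ω) - transitionSemigroup K n h f (X s ω)

/-- This is a conditional variance. To first order in h it is the carré du champ; the remainder of
f² contributes once and that of f twice, through 2 f r, whence the factor 3. -/
lemma transitionSemigroup_sq_sub_le (K : CoagulationKernel) {n : ℕ} (hn : 0 < n) (ℓ : ℕ+) {h : ℝ≥0}
    (h1 : h ≤ 1) (η : Config n) :
    transitionSemigroup K n h (fun ζ => density ℓ ζ ^ 2) η
      - transitionSemigroup K n h (density ℓ) η ^ 2
      ≤ h * (9 * K.bound / n) + 3 * expansionConst K n * (h : ℝ) ^ 2 := by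
  have hf := abs_density_le_one (n := n) ℓ
  have hf2 : ∀ ζ : Config n, |density ℓ ζ ^ 2| ≤ 1 := fun ζ => by
    rw [abs_pow]
    exact pow_le_one₀ (abs_nonneg _) (hf ζ)
  have e1 := (abs_le.1 (abs_transitionSemigroup_sub_le' K hf2 h1 η)).2
  have e2 := abs_transitionSemigroup_sub_le' K hf h1 η
  have e3 := mul_le_mul_of_nonneg_left (generator_density_sq_sub_le K hn ℓ η)
    h.coe_nonneg
  set a := transitionSemigroup K n h (density ℓ) η
  set r := a - density ℓ η - h * generator K n (density ℓ) η with hr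
  have e4 : |density ℓ η * r| ≤ expansionConst K n * (h : ℝ) ^ 2 := by
    rw [abs_mul]
    exact (mul_le_of_le_one_left (abs_nonneg _) (hf η)).trans e2
  have e5 := (abs_le.1 e4).1
  have e6 : a = density ℓ η + (h * generator K n (density ℓ) η + r) := by
    rw [hr]
    ring
  rw [e6]
  -- The square of the increment enters with a negative sign and is dropped.
  have e7 := sq_nonneg (h * generator K n (density ℓ) η + r)
  nlinarith

/-- The martingale obtained by summing the fluctuations along a grid of mesh `h`. -/
def fluctuationSum {n : ℕ} {Ω : Type*} (K : CoagulationKernel) (X : ℝ≥0 → Ω → Config n) (h : ℝ≥0) (f : Config n → ℝ)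
    (k : ℕ) (ω : Ω) : ℝ :=
  ∑ j ∈ Finset.range k, fluctuation K X h f (j * h) ω

lemma stronglyMeasurable_fluctuationSum {n : ℕ} {Ω : Type*} (K : CoagulationKernel) (X : ℝ≥0 → Ω → Config n)
    (h : ℝ≥0) (f : Config n → ℝ) (k : ℕ) :
    StronglyMeasurable[pastSigmaAlgebra X (k * h)] (fluctuationSum K X h f k) := by
  refine Finset.stronglyMeasurable_fun_sum _ fun j hj => ?_
  -- The last fluctuation, j = k - 1, looks ahead exactly to time kh.
  have hj' : (j : ℝ≥0) + 1 ≤ k := by exact_mod_cast Finset.mem_range.1 hj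
  have h1 : (j : ℝ≥0) * h + h ≤ k * h := by
    rw [← add_one_mul]
    gcongr
  exact (stronglyMeasurable_pastSigmaAlgebra X h1 f).sub
    (stronglyMeasurable_pastSigmaAlgebra X (le_self_add.trans h1) (transitionSemigroup K n h f))

lemma exists_abs_fluctuation_le {n : ℕ} {Ω : Type*} (K : CoagulationKernel) (X : ℝ≥0 → Ω → Config n) {h : ℝ≥0}
    (h1 : h ≤ 1) {f : Config n → ℝ} (hf : ∀ η, |f η| ≤ 1) :
    ∃ c, ∀ s ω, |fluctuation K X h f s ω| ≤ c := by
  obtain ⟨c, hc⟩ := exists_abs_transitionSemigroup_le K hf h1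
  exact ⟨1 + c, fun s ω => (abs_sub _ _).trans (add_le_add (hf _) (hc _))⟩

lemma exists_abs_fluctuationSum_le {n : ℕ} {Ω : Type*} (K : CoagulationKernel) (X : ℝ≥0 → Ω → Config n) {h : ℝ≥0}
    (h1 : h ≤ 1) {f : Config n → ℝ} (hf : ∀ η, |f η| ≤ 1) (k : ℕ) :
    ∃ c, ∀ ω, |fluctuationSum K X h f k ω| ≤ c := by
  obtain ⟨c, hc⟩ := exists_abs_fluctuation_le K X h1 hf
  exact ⟨∑ j ∈ Finset.range k, c, fun ω => (Finset.abs_sum_le_sum_abs _ _).trans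
    (Finset.sum_le_sum fun j _ => hc _ ω)⟩

/-! ### Consequences of the Markov property -/

section Markov

variable {K : CoagulationKernel} {n : ℕ} {Ω : Type*} [mΩ : MeasurableSpace Ω] {P : Measure Ω}
  {X : ℝ≥0 → Ω → Config n}

lemma IsMarcusLushnikov.pastSigmaAlgebra_le (hX : IsMarcusLushnikov K n P X) (s : ℝ≥0) :
    pastSigmaAlgebra X s ≤ mΩ :=
  iSup_le fun r => (hX.measurable r).comap_le

lemma IsMarcusLushnikov.measurable_comp (hX : IsMarcusLushnikov K n P X) (t : ℝ≥0)
    (f : Config n → ℝ) : Measurable fun ω => f (X t ω) :=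
  (Measurable.of_discrete (f := f)).comp (hX.measurable t)

lemma IsMarcusLushnikov.measurable_fluctuation (hX : IsMarcusLushnikov K n P X) (h : ℝ≥0)
    (f : Config n → ℝ) (s : ℝ≥0) : Measurable (fluctuation K X h f s) :=
  (hX.measurable_comp (s + h) f).sub (hX.measurable_comp s (transitionSemigroup K n h f))

lemma IsMarcusLushnikov.measurable_fluctuationSum (hX : IsMarcusLushnikov K n P X) (h : ℝ≥0)
    (f : Config n → ℝ) (k : ℕ) : Measurable (fluctuationSum K X h f k) :=
  Finset.measurable_fun_sum _ fun _ _ => hX.measurable_fluctuation h f _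

variable [IsProbabilityMeasure P]

lemma IsMarcusLushnikov.integrable_comp (hX : IsMarcusLushnikov K n P X) (t : ℝ≥0)
    {f : Config n → ℝ} {M : ℝ} (hf : ∀ η, |f η| ≤ M) : Integrable (fun ω => f (X t ω)) P :=
  Integrable.of_bound (hX.measurable_comp t f).aestronglyMeasurable M
    (Eventually.of_forall fun _ => hf _)

/-- The Markov property tested against a bounded variable of the past. Every later use of the Markov
property goes through this identity. -/
lemma IsMarcusLushnikov.integral_mul (hX : IsMarcusLushnikov K n P X) (s h : ℝ≥0)
    {f : Config n → ℝ} {M : ℝ} (hf : ∀ η, |f η| ≤ M) {Y : Ω → ℝ}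
    (hY : StronglyMeasurable[pastSigmaAlgebra X s] Y) {c : ℝ} (hc : ∀ ω, |Y ω| ≤ c) :
    ∫ ω, Y ω * f (X (s + h) ω) ∂P = ∫ ω, Y ω * transitionSemigroup K n h f (X s ω) ∂P := by
  have hle := hX.pastSigmaAlgebra_le s
  have h1 := condExp_stronglyMeasurable_mul_of_bound hle hY (hX.integrable_comp (s + h) hf) c
    (Eventually.of_forall hc)
  have h2 := hX.markov s h f ⟨M, hf⟩
  have h3 : ∫ ω, Y ω * f (X (s + h) ω) ∂P
      = ∫ ω, (Y * fun ω => f (X (s + h) ω)) ω ∂P := rfl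
  rw [h3, ← integral_condExp hle]
  refine integral_congr_ae ?_
  filter_upwards [h1, h2] with ω h1 h2
  rw [h1, Pi.mul_apply, h2]

lemma IsMarcusLushnikov.ae_mem_reachable (hX : IsMarcusLushnikov K n P X) (s h : ℝ≥0) :
    ∀ᵐ ω ∂P, X (s + h) ω ∈ reachable (X s ω) := by
  classical
  -- There are countably many configurations. For each η, test the indicator of {X_s = η} against
  -- that of the complement of `reachable η`, on which the semigroup vanishes at η.
  suffices H : ∀ η : Config n, ∀ᵐ ω ∂P, X s ω = η → X (s + h) ω ∈ reachable η by
    filter_upwards [ae_all_iff.2 H] with ω hω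
    exact hω _ rfl
  intro η
  let f : Config n → ℝ := fun ζ => if ζ ∈ reachable η then 0 else 1
  let g : Config n → ℝ := fun ζ => if ζ = η then 1 else 0
  have hf : ∀ ζ, |f ζ| ≤ 1 := fun ζ => by
    simp only [f]
    split_ifs <;> simp
  have hg : ∀ ζ, |g ζ| ≤ 1 := fun ζ => by
    simp only [g]
    split_ifs <;> simp
  have h1 := hX.integral_mul s h hf (stronglyMeasurable_pastSigmaAlgebra X le_rfl g)
    (fun ω => hg (X s ω))
  have h2 : ∀ ω, g (X s ω) * transitionSemigroup K n h f (X s ω) = 0 := by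
    intro ω
    simp only [g]
    split_ifs with h
    · rw [h, transitionSemigroup_eq_zero (isAbsorbing_reachable K η) (fun ζ hζ => if_pos hζ) _
        (self_mem_reachable η), mul_zero]
    · rw [zero_mul]
  simp only [h2, integral_zero] at h1
  have hnn : ∀ ω, 0 ≤ g (X s ω) * f (X (s + h) ω) := by
    intro ω
    simp only [f, g]
    split_ifs <;> simp
  have hgf : Integrable (fun ω => g (X s ω) * f (X (s + h) ω)) P := by
    refine Integrable.of_bound ((hX.measurable_comp s g).mul
      (hX.measurable_comp (s + h) f)).aestronglyMeasurable 1 (Eventually.of_forall fun ω => ?_)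
    rw [norm_mul]
    exact mul_le_one₀ (hg _) (norm_nonneg _) (hf _)
  rw [integral_eq_zero_iff_of_nonneg hnn hgf] at h1
  filter_upwards [h1] with ω hω hη
  by_contra hcon
  simp [f, g, hη, hcon] at hω

/-- Almost surely, the whole path moves along reachable configurations. -/
lemma IsMarcusLushnikov.ae_forall_mem_reachable (hX : IsMarcusLushnikov K n P X) :
    ∀ᵐ ω ∂P, ∀ s t, s ≤ t → X t ω ∈ reachable (X s ω) := by
  obtain ⟨D, hDc, hD⟩ := TopologicalSpace.exists_countable_dense ℝ≥0
  have h1 : ∀ᵐ ω ∂P, ∀ d ∈ D, ∀ e ∈ D, d ≤ e → X e ω ∈ reachable (X d ω) := by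
    rw [ae_ball_iff hDc]
    intro d _
    rw [ae_ball_iff hDc]
    intro e _
    by_cases hde : d ≤ e
    · have := hX.ae_mem_reachable d (e - d)
      rw [add_tsub_cancel_of_le hde] at this
      filter_upwards [this] with ω hω _ using hω
    · exact Eventually.of_forall fun ω h => absurd h hde
  filter_upwards [h1] with ω hω s t hst
  rcases hst.eq_or_lt with rfl | hst
  · exact self_mem_reachable _
  -- Replace s by a dense time d in (s, t) and t by a dense time e > t, without changing the values
  -- of the path.
  obtain ⟨d, hd, _, hdt, hdx⟩ := exists_mem_dense_eq hD (hX.cadlag ω) hst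
  obtain ⟨e, he, hte, _, hex⟩ := exists_mem_dense_eq hD (hX.cadlag ω) (lt_add_one t)
  have := hω d hd e he (hdt.trans hte).le
  rwa [hdx, hex] at this

lemma IsMarcusLushnikov.ae_forall_sum_eq (hX : IsMarcusLushnikov K n P X) :
    ∀ᵐ ω ∂P, ∀ t, ∑ x, X t ω x = n := by
  filter_upwards [hX.ae_forall_mem_reachable, hX.initial] with ω h h0 t
  rw [(h 0 t zero_le).1, h0]
  simp [Config.mono]

/-! ### The martingale part -/

/-- By the Markov property the second moment is the mean of the conditional variance at X_s. -/
lemma IsMarcusLushnikov.integral_fluctuation_sq_le (hX : IsMarcusLushnikov K n P X) (hn : 0 < n)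
    (ℓ : ℕ+) {h : ℝ≥0} (h1 : h ≤ 1) (s : ℝ≥0) :
    ∫ ω, fluctuation K X h (density ℓ) s ω ^ 2 ∂P
      ≤ h * (9 * K.bound / n) + 3 * expansionConst K n * (h : ℝ) ^ 2 := by
  have hf := abs_density_le_one (n := n) ℓ
  have hf2 : ∀ ζ : Config n, |density ℓ ζ ^ 2| ≤ 1 := fun ζ => by
    rw [abs_pow]
    exact pow_le_one₀ (abs_nonneg _) (hf ζ)
  set f : Config n → ℝ := density ℓ with hfdef
  set g : Config n → ℝ := transitionSemigroup K n h f with hg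
  set g2 : Config n → ℝ := transitionSemigroup K n h (fun ζ => f ζ ^ 2) with hg2
  obtain ⟨c, hc⟩ := exists_abs_transitionSemigroup_le K hf h1
  obtain ⟨c2, hc2⟩ := exists_abs_transitionSemigroup_le K hf2 h1
  have hc0 : 0 ≤ c := (abs_nonneg _).trans (hc (fun _ => 0))
  have hgg : ∀ η, |g η ^ 2| ≤ c ^ 2 := fun η => by
    rw [abs_pow]
    exact pow_le_pow_left₀ (abs_nonneg _) (hc η) 2
  have i1 := hX.integrable_comp (s + h) hf2
  have i2 := hX.integrable_comp s hc2
  have i3 := hX.integrable_comp s hgg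
  have i4 : Integrable (fun ω => g (X s ω) * f (X (s + h) ω)) P := by
    refine Integrable.of_bound ((hX.measurable_comp s g).mul
      (hX.measurable_comp (s + h) f)).aestronglyMeasurable (c * 1) (Eventually.of_forall fun ω => ?_)
    rw [norm_mul]
    exact mul_le_mul (hc _) (hf _) (norm_nonneg _) hc0
  have m1 : ∫ ω, f (X (s + h) ω) ^ 2 ∂P = ∫ ω, g2 (X s ω) ∂P := by
    have := hX.integral_mul s h hf2 (Y := fun _ => 1) stronglyMeasurable_const (c := 1) (by simp)
    simpa using this
  have m2 : ∫ ω, g (X s ω) * f (X (s + h) ω) ∂P = ∫ ω, g (X s ω) ^ 2 ∂P := by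
    rw [hX.integral_mul s h hf (stronglyMeasurable_pastSigmaAlgebra X le_rfl g)
      (fun ω => hc (X s ω))]
    simp only [sq, ← hg]
  have e1 : ∫ ω, fluctuation K X h f s ω ^ 2 ∂P = ∫ ω, (g2 (X s ω) - g (X s ω) ^ 2) ∂P := by
    have : ∀ ω, fluctuation K X h f s ω ^ 2
        = f (X (s + h) ω) ^ 2 - 2 * (g (X s ω) * f (X (s + h) ω)) + g (X s ω) ^ 2 := by
      intro ω
      rw [fluctuation]
      ring
    simp only [this]
    have i5 : Integrable (fun ω => f (X (s + h) ω) ^ 2 - 2 * (g (X s ω) * f (X (s + h) ω))) P :=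
      i1.sub (i4.const_mul 2)
    rw [integral_add i5 i3, integral_sub i1 (i4.const_mul 2),
      integral_const_mul, m1, m2, integral_sub i2 i3]
    ring
  rw [e1]
  refine (integral_mono (i2.sub i3) (integrable_const _) fun ω =>
    transitionSemigroup_sq_sub_le K hn ℓ h1 (X s ω)).trans_eq ?_
  simp

/-- The fluctuations are orthogonal. -/
lemma IsMarcusLushnikov.integral_fluctuationSum_sq_le (hX : IsMarcusLushnikov K n P X)
    (hn : 0 < n) (ℓ : ℕ+) {h : ℝ≥0} (h1 : h ≤ 1) (k : ℕ) :
    ∫ ω, fluctuationSum K X h (density ℓ) k ω ^ 2 ∂P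
      ≤ k * (h * (9 * K.bound / n) + 3 * expansionConst K n * (h : ℝ) ^ 2) := by
  have hf := abs_density_le_one (n := n) ℓ
  induction k with
  | zero => simp [fluctuationSum]
  | succ k ih =>
    set S := fluctuationSum K X h (density ℓ) k with hS
    set D := fluctuation K X h (density ℓ) (k * h) with hD
    obtain ⟨c, hc⟩ := exists_abs_fluctuationSum_le K X h1 hf k
    obtain ⟨d, hd⟩ := exists_abs_fluctuation_le K X h1 hf
    obtain ⟨e, he⟩ := exists_abs_transitionSemigroup_le K hf h1
    have mS := hX.measurable_fluctuationSum h (density ℓ) k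
    have mD := hX.measurable_fluctuation h (density ℓ) (k * h)
    have iS : Integrable (fun ω => S ω ^ 2) P :=
      Integrable.of_bound (mS.pow_const 2).aestronglyMeasurable (c ^ 2)
        (Eventually.of_forall fun ω => by
          rw [norm_pow]
          exact pow_le_pow_left₀ (norm_nonneg _) (hc ω) 2)
    have iD : Integrable (fun ω => D ω ^ 2) P :=
      Integrable.of_bound (mD.pow_const 2).aestronglyMeasurable (d ^ 2)
        (Eventually.of_forall fun ω => by
          rw [norm_pow]
          exact pow_le_pow_left₀ (norm_nonneg _) (hd _ ω) 2)
    have ibdd : ∀ {r : Ω → ℝ} {b : ℝ}, Measurable r → (∀ ω, |r ω| ≤ b) →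
        Integrable (fun ω => S ω * r ω) P := by
      intro r b hr hb
      refine Integrable.of_bound (mS.mul hr).aestronglyMeasurable (c * b)
        (Eventually.of_forall fun ω => ?_)
      rw [norm_mul]
      exact mul_le_mul (hc ω) (hb ω) (norm_nonneg _) ((abs_nonneg _).trans (hc ω))
    have iSD : Integrable (fun ω => S ω * D ω) P := ibdd mD (hd _)
    -- S is determined by the path up to time kh, and D has conditional mean zero given that past.
    have h0 : ∫ ω, S ω * D ω ∂P = 0 := by
      have hmul := hX.integral_mul (k * h) h hf (stronglyMeasurable_fluctuationSum K X h _ k) hc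
      have : ∀ ω, S ω * D ω = S ω * density ℓ (X (k * h + h) ω)
          - S ω * transitionSemigroup K n h (density ℓ) (X (k * h) ω) := fun ω => by
        rw [hD, fluctuation]
        ring
      simp only [this]
      rw [integral_sub (ibdd (hX.measurable_comp _ _) fun ω => hf _)
        (ibdd (hX.measurable_comp _ _) fun ω => he _), hmul, sub_self]
    have hexp : ∀ ω, fluctuationSum K X h (density ℓ) (k + 1) ω ^ 2
        = S ω ^ 2 + 2 * (S ω * D ω) + D ω ^ 2 := by
      intro ω
      rw [fluctuationSum, Finset.sum_range_succ]
      change (S ω + D ω) ^ 2 = _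
      ring
    simp only [hexp]
    rw [integral_add (iS.fun_add (iSD.const_mul 2)) iD, integral_add iS (iSD.const_mul 2),
      integral_const_mul, h0]
    have := hX.integral_fluctuation_sq_le hn ℓ h1 (k * h)
    push_cast
    linarith

end Markov

/-! ### Comparison of the chain with the Smoluchowski equation -/

/-- Discrete Grönwall inequality: the right-hand side grows by a factor of at most 1 + a ≤ e^a at
each step. -/
lemma le_mul_exp_of_le_add_sum {d : ℕ → ℝ} {a b : ℝ} (ha : 0 ≤ a) (hb : 0 ≤ b) {m : ℕ}
    (h : ∀ k ≤ m, d k ≤ b + ∑ j ∈ Finset.range k, a * d j) : d m ≤ b * Real.exp (m * a) := by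
  have key : ∀ k ≤ m, b + ∑ j ∈ Finset.range k, a * d j ≤ b * (1 + a) ^ k := by
    intro k
    induction k with
    | zero => simp
    | succ k ih =>
      intro hk
      have h1 := ih (by omega)
      have h2 := mul_le_mul_of_nonneg_left ((h k (by omega)).trans h1) ha
      rw [Finset.sum_range_succ, pow_succ]
      linarith
  refine ((h m le_rfl).trans (key m le_rfl)).trans (mul_le_mul_of_nonneg_left ?_ hb)
  rw [Real.exp_nat_mul]
  refine pow_le_pow_left₀ (by linarith) ?_ m
  linarith [Real.add_one_le_exp a]

section Comparison

variable {K : CoagulationKernel} {T : ℝ} {hT : 0 ≤ T} {u : C(Set.Icc 0 T, MPlus)}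

/-- The drift of the chain over a time step, compared with the Smoluchowski equation. -/
lemma IsWeakSolution.sum_abs_drift_le (hu : IsWeakSolution K hT u) {n : ℕ} (hn : 0 < n)
    {r h : ℝ≥0} (h1 : h ≤ 1) (hrh : (r : ℝ) + h ≤ T) (η : Config n) (s : Finset ℕ+) :
    ∑ ℓ ∈ s, |transitionSemigroup K n h (density ℓ) η - density ℓ η
        - (extendPath hT u (r + h) - extendPath hT u r) ℓ|
      ≤ h * (6 * K.bound) * ‖(empiricalDensity η : EllOne) - extendPath hT u r‖
        + (s.card * (expansionConst K n * (h : ℝ) ^ 2 + h * (3 * K.bound / n))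
          + 18 * K.bound ^ 2 * (h : ℝ) ^ 2) := by
  set W := extendPath hT u
  -- Four errors: the semigroup expansion and the diagonal of the generator, bounded coordinate by
  -- coordinate and so multiplied by `s.card`; the difference `v₁` of the vector fields and the
  -- Euler error `v₂`, summed in ℓ¹ at no such cost.
  set v₁ := smoluchowskiOp K (empiricalDensity η) - smoluchowskiOp K (W r)
  set v₂ := W (r + h) - W r - (h : ℝ) • smoluchowskiOp K (W r)
  have hp : ∀ ℓ ∈ s, |transitionSemigroup K n h (density ℓ) η - density ℓ η
        - (W (r + h) - W r) ℓ|
      ≤ (expansionConst K n * (h : ℝ) ^ 2 + h * (3 * K.bound / n)) + (h * |v₁ ℓ| + |v₂ ℓ|) := by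
    intro ℓ _
    have e1 := abs_transitionSemigroup_sub_le' K (abs_density_le_one (n := n) ℓ) h1 η
    have e2 := abs_generator_density_sub_le K hn ℓ η
    have e3 : transitionSemigroup K n h (density ℓ) η - density ℓ η - (W (r + h) - W r) ℓ
        = (transitionSemigroup K n h (density ℓ) η - density ℓ η
            - h * generator K n (density ℓ) η)
          + h * (generator K n (density ℓ) η - smoluchowskiOp K (empiricalDensity η) ℓ)
          + h * v₁ ℓ - v₂ ℓ := by
      simp only [v₁, v₂, lp.coeFn_sub, Pi.sub_apply, lp.coeFn_smul, Pi.smul_apply, smul_eq_mul]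
      ring
    rw [e3]
    refine (abs_sub _ _).trans ?_
    have e4 := abs_add_three (transitionSemigroup K n h (density ℓ) η - density ℓ η
            - h * generator K n (density ℓ) η)
          (h * (generator K n (density ℓ) η - smoluchowskiOp K (empiricalDensity η) ℓ))
          (h * v₁ ℓ)
    rw [abs_mul, abs_mul, abs_of_nonneg h.coe_nonneg] at e4
    have e5 := mul_le_mul_of_nonneg_left e2 h.coe_nonneg
    linarith
  have hs₁ := v₁.sum_abs_le s
  have hs₂ := v₂.sum_abs_le s
  have hn₁ : ‖v₁‖ ≤ 6 * K.bound * ‖(empiricalDensity η : EllOne) - W r‖ :=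
    norm_smoluchowskiOp_sub_le K (empiricalDensity η).2 (extendPath_mem hT u r)
  have hn₂ : ‖v₂‖ ≤ 18 * K.bound ^ 2 * (h : ℝ) ^ 2 :=
    hu.norm_euler_error_le r.coe_nonneg h.coe_nonneg hrh
  refine (Finset.sum_le_sum hp).trans ?_
  rw [Finset.sum_add_distrib, Finset.sum_add_distrib (f := fun ℓ => (h : ℝ) * |v₁ ℓ|),
    ← Finset.mul_sum, Finset.sum_const, nsmul_eq_mul]
  have := mul_le_mul_of_nonneg_left (hs₁.trans hn₁) h.coe_nonneg
  linarith

variable {n : ℕ} {Ω : Type*} {X : ℝ≥0 → Ω → Config n}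

/-- The distance of the empirical density at time `t` from the solution. -/
def deviation (hT : 0 ≤ T) (u : C(Set.Icc 0 T, MPlus)) (t : ℝ≥0) (η : Config n) : ℝ :=
  ‖(empiricalDensity η : EllOne) - extendPath hT u t‖

/-- Telescoping along the grid, each increment of the density being split into its conditional mean
and a fluctuation. -/
lemma density_sub_eq (K : CoagulationKernel) (W : ℝ → EllOne) (X : ℝ≥0 → Ω → Config n) (h : ℝ≥0)
    (ω : Ω) (ℓ : ℕ+) (h0 : density ℓ (X 0 ω) = W 0 ℓ) (k : ℕ) :
    density ℓ (X (k * h) ω) - W (k * h : ℝ≥0) ℓ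
      = ∑ j ∈ Finset.range k, (transitionSemigroup K n h (density ℓ) (X (j * h) ω)
          - density ℓ (X (j * h) ω)
          - (W ((j * h : ℝ≥0) + h) - W (j * h : ℝ≥0)) ℓ)
        + fluctuationSum K X h (density ℓ) k ω := by
  induction k with
  | zero => simp [fluctuationSum, h0]
  | succ k ih =>
    have e1 : ((k + 1 : ℕ) : ℝ≥0) * h = k * h + h := by
      push_cast
      ring
    have e2 : ((k * h + h : ℝ≥0) : ℝ) = (k * h : ℝ≥0) + h := by push_cast; ring
    rw [fluctuationSum, Finset.sum_range_succ, Finset.sum_range_succ, e1, e2]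
    rw [fluctuationSum] at ih
    rw [fluctuation, lp.coeFn_sub, Pi.sub_apply]
    linarith

/-- A pathwise inequality, ready for Grönwall: the coordinates up to L carry drift and fluctuation,
while 1/L and τ account for the tails of the chain and of the solution. -/
lemma norm_empirical_sub_le (hu : IsWeakSolution K hT u)
    (hu0 : (u ⟨0, Set.left_mem_Icc.2 hT⟩ : EllOne) = deltaOne) (hn : 0 < n) {h : ℝ≥0}
    (h1 : h ≤ 1) (ω : Ω) (hω0 : X 0 ω = Config.mono n) (hωm : ∀ t, ∑ x, X t ω x = n) (L : ℕ+)
    {τ : ℝ} (hτ : ∀ t, EllOne.total (extendPath hT u t)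
      - ∑ ℓ ∈ Finset.Icc 1 L, extendPath hT u t ℓ ≤ τ) (k : ℕ) (hk : (k : ℝ) * h ≤ T) :
    deviation hT u (k * h) (X (k * h) ω)
      ≤ ∑ j ∈ Finset.range k, h * (6 * K.bound) * deviation hT u (j * h) (X (j * h) ω)
        + k * (L * (expansionConst K n * (h : ℝ) ^ 2 + h * (3 * K.bound / n))
          + 18 * K.bound ^ 2 * (h : ℝ) ^ 2)
        + ∑ ℓ ∈ Finset.Icc 1 L, |fluctuationSum K X h (density ℓ) k ω| + 1 / (L : ℝ) + τ := by
  set W := extendPath hT u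
  set s := Finset.Icc 1 L
  have hs : (s.card : ℝ) = L := by simp [s]
  have hW0 : W 0 = deltaOne := by
    rw [← hu0, ← extendPath_coe hT u]
  have e0 : ∀ ℓ, density ℓ (X 0 ω) = W 0 ℓ := fun ℓ => by
    rw [density, hω0, empiricalDensity_mono hn, hW0]
  have e1 := EllOne.norm_le_sum_add (empiricalDensity (X (k * h) ω)).2
    (extendPath_mem hT u (k * h : ℝ≥0)) s
  have e2 := total_empiricalDensity_sub_sum_le (X (k * h) ω) (hωm _) L
  have e3 := hτ (k * h : ℝ≥0)
  have e4 : ∑ ℓ ∈ s, |(empiricalDensity (X (k * h) ω) : EllOne) ℓ - W (k * h : ℝ≥0) ℓ|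
      ≤ ∑ j ∈ Finset.range k, (h * (6 * K.bound) * deviation hT u (j * h) (X (j * h) ω)
          + (L * (expansionConst K n * (h : ℝ) ^ 2 + h * (3 * K.bound / n))
            + 18 * K.bound ^ 2 * (h : ℝ) ^ 2))
        + ∑ ℓ ∈ s, |fluctuationSum K X h (density ℓ) k ω| := by
    calc _ ≤ ∑ ℓ ∈ s, (∑ j ∈ Finset.range k,
            |transitionSemigroup K n h (density ℓ) (X (j * h) ω) - density ℓ (X (j * h) ω)
              - (W ((j * h : ℝ≥0) + h) - W (j * h : ℝ≥0)) ℓ|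
            + |fluctuationSum K X h (density ℓ) k ω|) := by
          refine Finset.sum_le_sum fun ℓ _ => ?_
          have := density_sub_eq K W X h ω ℓ (e0 ℓ) k
          rw [density] at this
          rw [this]
          exact (abs_add_le _ _).trans (add_le_add_left (Finset.abs_sum_le_sum_abs _ _) _)
      _ ≤ _ := by
          rw [Finset.sum_add_distrib, Finset.sum_comm]
          refine add_le_add_left (Finset.sum_le_sum fun j hj => ?_) _
          rw [← hs]
          refine hu.sum_abs_drift_le hn h1 ?_ _ s
          have : (j : ℝ) + 1 ≤ k := by exact_mod_cast Finset.mem_range.1 hj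
          push_cast
          calc (j : ℝ) * h + h = (j + 1) * h := by ring
            _ ≤ k * h := by gcongr
            _ ≤ T := hk
  rw [Finset.sum_add_distrib, Finset.sum_const, Finset.card_range, nsmul_eq_mul] at e4
  unfold deviation at *
  linarith

lemma deviation_nonneg (t : ℝ≥0) (η : Config n) : 0 ≤ deviation hT u t η := norm_nonneg _

lemma abs_deviation_le (t : ℝ≥0) (η : Config n) : |deviation hT u t η| ≤ 2 := by
  rw [abs_of_nonneg (deviation_nonneg _ _)]
  have h1 := norm_le_one_of_mem (empiricalDensity η).2
  have h2 := norm_le_one_of_mem (extendPath_mem hT u t)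
  exact (norm_sub_le _ _).trans (by linarith)

variable [MeasurableSpace Ω] {P : Measure Ω} [IsProbabilityMeasure P]

lemma IsMarcusLushnikov.integral_abs_fluctuationSum_le (hX : IsMarcusLushnikov K n P X)
    (hn : 0 < n) (ℓ : ℕ+) {h : ℝ≥0} (h1 : h ≤ 1) (k : ℕ) {a : ℝ} (ha : 0 < a) :
    Integrable (fun ω => |fluctuationSum K X h (density ℓ) k ω|) P ∧
    ∫ ω, |fluctuationSum K X h (density ℓ) k ω| ∂P
      ≤ a + k * (h * (9 * K.bound / n) + 3 * expansionConst K n * (h : ℝ) ^ 2) / a := by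
  obtain ⟨c, hc⟩ := exists_abs_fluctuationSum_le K X h1 (abs_density_le_one (n := n) ℓ) k
  have hm := hX.measurable_fluctuationSum h (density ℓ) k
  have i1 : Integrable (fluctuationSum K X h (density ℓ) k) P :=
    Integrable.of_bound hm.aestronglyMeasurable c (Eventually.of_forall hc)
  have i2 : Integrable (fun ω => fluctuationSum K X h (density ℓ) k ω ^ 2) P :=
    Integrable.of_bound (hm.pow_const 2).aestronglyMeasurable (c ^ 2)
      (Eventually.of_forall fun ω => by
        rw [norm_pow]
        exact pow_le_pow_left₀ (norm_nonneg _) (hc ω) 2)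
  refine ⟨i1.abs, ?_⟩
  -- |x| ≤ a + x²/a turns the second moment into a first moment; the parameter a is chosen at the
  -- very end.
  calc _ ≤ ∫ ω, (a + fluctuationSum K X h (density ℓ) k ω ^ 2 / a) ∂P := by
        refine integral_mono i1.abs ((integrable_const a).add (i2.div_const a)) fun ω => ?_
        have : |fluctuationSum K X h (density ℓ) k ω| * a
            ≤ (a + fluctuationSum K X h (density ℓ) k ω ^ 2 / a) * a := by
          rw [add_mul, div_mul_cancel₀ _ ha.ne', ← sq_abs]
          nlinarith [sq_nonneg (|fluctuationSum K X h (density ℓ) k ω| - a),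
            abs_nonneg (fluctuationSum K X h (density ℓ) k ω)]
        exact le_of_mul_le_mul_right this ha
    _ ≤ _ := by
        rw [integral_add (integrable_const a) (i2.div_const a), integral_div, integral_const,
          probReal_univ, one_smul]
        gcongr
        exact hX.integral_fluctuationSum_sq_le hn ℓ h1 k

/-- Expectations of the pathwise inequality, followed by discrete Grönwall with a = 6Ch. Each kh is
bounded by T beforehand, so that the additive constant does not depend on k. -/
lemma IsMarcusLushnikov.integral_deviation_grid_le (hX : IsMarcusLushnikov K n P X)
    (hu : IsWeakSolution K hT u) (hu0 : (u ⟨0, Set.left_mem_Icc.2 hT⟩ : EllOne) = deltaOne)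
    (hn : 0 < n) {h : ℝ≥0} (h1 : h ≤ 1) (L : ℕ+) {τ : ℝ}
    (hτ : ∀ t, EllOne.total (extendPath hT u t)
      - ∑ ℓ ∈ Finset.Icc 1 L, extendPath hT u t ℓ ≤ τ) (m : ℕ) (hm : (m : ℝ) * h ≤ T)
    (hτ0 : 0 ≤ τ) {a : ℝ} (ha : 0 < a) :
    ∫ ω, deviation hT u (m * h) (X (m * h) ω) ∂P
      ≤ (T * (L * (expansionConst K n * h + 3 * K.bound / n) + 18 * K.bound ^ 2 * h)
        + L * (a + T * (9 * K.bound / n + 3 * expansionConst K n * h) / a) + 1 / (L : ℝ) + τ)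
        * Real.exp (6 * K.bound * T) := by
  have hK := K.bound_nonneg
  have hE := expansionConst_nonneg K n
  set b := T * (L * (expansionConst K n * h + 3 * K.bound / n) + 18 * K.bound ^ 2 * h)
        + L * (a + T * (9 * K.bound / n + 3 * expansionConst K n * h) / a) + 1 / (L : ℝ) + τ with hb
  have hb0 : 0 ≤ b := by positivity
  have hi : ∀ t r, Integrable (fun ω => deviation hT u t (X r ω)) P := fun t r =>
    hX.integrable_comp r (abs_deviation_le t)
  have key : ∀ k ≤ m, ∫ ω, deviation hT u (k * h) (X (k * h) ω) ∂P
      ≤ b + ∑ j ∈ Finset.range k, h * (6 * K.bound) *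
        ∫ ω, deviation hT u (j * h) (X (j * h) ω) ∂P := by
    intro k hk
    have hkh : (k : ℝ) * h ≤ T := by
      refine le_trans ?_ hm
      gcongr
    have hF := fun ℓ => hX.integral_abs_fluctuationSum_le hn ℓ h1 k ha
    set c₁ := k * (L * (expansionConst K n * (h : ℝ) ^ 2 + h * (3 * K.bound / n))
          + 18 * K.bound ^ 2 * (h : ℝ) ^ 2) with hc₁
    have j1 : Integrable (fun ω => ∑ j ∈ Finset.range k,
        h * (6 * K.bound) * deviation hT u (j * h) (X (j * h) ω)) P :=
      integrable_finsetSum _ fun j _ => (hi _ _).const_mul _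
    have j2 : Integrable (fun ω => ∑ ℓ ∈ Finset.Icc 1 L,
        |fluctuationSum K X h (density ℓ) k ω|) P :=
      integrable_finsetSum _ fun ℓ _ => (hF ℓ).1
    have step : ∫ ω, deviation hT u (k * h) (X (k * h) ω) ∂P
        ≤ ∫ ω, (∑ j ∈ Finset.range k, h * (6 * K.bound) * deviation hT u (j * h) (X (j * h) ω)
          + ∑ ℓ ∈ Finset.Icc 1 L, |fluctuationSum K X h (density ℓ) k ω|
          + (c₁ + 1 / (L : ℝ) + τ)) ∂P := by
      refine integral_mono_ae (hi _ _) ((j1.add j2).add (integrable_const _)) ?_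
      filter_upwards [hX.initial, hX.ae_forall_sum_eq] with ω hω0 hωm
      have := norm_empirical_sub_le hu hu0 hn h1 ω hω0 hωm L hτ k hkh
      linarith
    rw [integral_add (j1.fun_add j2) (integrable_const _), integral_add j1 j2,
      integral_finsetSum _ fun j _ => (hi _ _).const_mul _,
      integral_finsetSum _ fun ℓ _ => (hF ℓ).1, integral_const, probReal_univ, one_smul] at step
    simp only [integral_const_mul] at step
    have s1 : ∑ ℓ ∈ Finset.Icc 1 L, ∫ ω, |fluctuationSum K X h (density ℓ) k ω| ∂P
        ≤ L * (a + T * (9 * K.bound / n + 3 * expansionConst K n * h) / a) := by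
      refine (Finset.sum_le_card_nsmul _ _
        (a + T * (9 * K.bound / n + 3 * expansionConst K n * h) / a) fun ℓ _ => ?_).trans_eq
        (by rw [PNat.card_Icc, nsmul_eq_mul]; simp)
      refine (hF ℓ).2.trans ?_
      rw [show (k : ℝ) * (h * (9 * K.bound / n) + 3 * expansionConst K n * (h : ℝ) ^ 2)
        = (k * h) * (9 * K.bound / n + 3 * expansionConst K n * h) by ring]
      gcongr
    have s2 : c₁ ≤ T * (L * (expansionConst K n * h + 3 * K.bound / n)
        + 18 * K.bound ^ 2 * h) := by
      rw [hc₁, show (k : ℝ) * (L * (expansionConst K n * (h : ℝ) ^ 2 + h * (3 * K.bound / n))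
          + 18 * K.bound ^ 2 * (h : ℝ) ^ 2) = (k * h) * (L * (expansionConst K n * h
          + 3 * K.bound / n) + 18 * K.bound ^ 2 * h) by ring]
      gcongr
    linarith
  refine (le_mul_exp_of_le_add_sum (by positivity) hb0 key).trans ?_
  refine mul_le_mul_of_nonneg_left (Real.exp_le_exp.2 ?_) hb0
  calc (m : ℝ) * (h * (6 * K.bound)) = (6 * K.bound) * (m * h) := by ring
    _ ≤ _ := by gcongr

/-- A bound on the expected deviation at a fixed time. -/
lemma IsMarcusLushnikov.integral_deviation_le (hX : IsMarcusLushnikov K n P X)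
    (hu : IsWeakSolution K hT u) (hu0 : (u ⟨0, Set.left_mem_Icc.2 hT⟩ : EllOne) = deltaOne)
    (hn : 0 < n) (L : ℕ+) {τ : ℝ}
    (hτ : ∀ t, EllOne.total (extendPath hT u t)
      - ∑ ℓ ∈ Finset.Icc 1 L, extendPath hT u t ℓ ≤ τ) (hτ0 : 0 ≤ τ) {t : ℝ≥0} (ht : (t : ℝ) ≤ T)
    {a : ℝ} (ha : 0 < a) :
    ∫ ω, deviation hT u t (X t ω) ∂P
      ≤ (T * (L * (3 * K.bound / n)) + L * (a + T * (9 * K.bound / n) / a) + 1 / (L : ℝ) + τ)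
        * Real.exp (6 * K.bound * T) := by
  -- With n fixed the mesh tends to 0, which removes `expansionConst K n` although it is exponential
  -- in n.
  set F : ℝ → ℝ := fun h =>
    (T * (L * (expansionConst K n * h + 3 * K.bound / n) + 18 * K.bound ^ 2 * h)
        + L * (a + T * (9 * K.bound / n + 3 * expansionConst K n * h) / a) + 1 / (L : ℝ) + τ)
        * Real.exp (6 * K.bound * T) with hF
  have hFc : Continuous F := by fun_prop
  have hlim0 : Tendsto (fun m : ℕ => (t / ((m : ℝ≥0) + 1) : ℝ≥0)) atTop (𝓝 0) := by
    have h : Tendsto (fun m : ℕ => (t : ℝ) / ((m : ℝ) + 1)) atTop (𝓝 0) :=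
      tendsto_const_nhds.div_atTop (tendsto_natCast_atTop_atTop.atTop_add tendsto_const_nhds)
    rw [← NNReal.tendsto_coe]
    simpa using h
  have hlim : Tendsto (fun m : ℕ => F (t / ((m : ℝ≥0) + 1) : ℝ≥0)) atTop (𝓝 (F 0)) := by
    refine (hFc.tendsto 0).comp ?_
    have := NNReal.tendsto_coe.2 hlim0
    simpa using this
  have hF0 : F 0 = (T * (L * (3 * K.bound / n)) + L * (a + T * (9 * K.bound / n) / a)
      + 1 / (L : ℝ) + τ) * Real.exp (6 * K.bound * T) := by
    simp [hF]
  rw [← hF0]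
  refine ge_of_tendsto hlim ?_
  filter_upwards [hlim0.eventually_le_const zero_lt_one] with m hm
  -- The mesh t/(m+1) makes t itself a grid point.
  have hmt : ((m + 1 : ℕ) : ℝ≥0) * (t / ((m : ℝ≥0) + 1)) = t := by
    push_cast
    exact mul_div_cancel₀ _ (by positivity)
  have := hX.integral_deviation_grid_le hu hu0 hn hm L hτ (m + 1)
    (by rw [← NNReal.coe_natCast, ← NNReal.coe_mul, hmt]; exact ht) hτ0 ha
  rwa [hmt] at this

end Comparison

/-! ### Convergence at a fixed time -/

/-- The tails of a continuous path in `ℓ¹` are uniformly small. -/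
lemma exists_tail_le {T : ℝ} (hT : 0 ≤ T) (u : C(Set.Icc 0 T, MPlus)) {δ : ℝ} (hδ : 0 < δ) :
    ∃ L₀ : ℕ+, ∀ L ≥ L₀, ∀ t, EllOne.total (extendPath hT u t)
      - ∑ ℓ ∈ Finset.Icc 1 L, extendPath hT u t ℓ ≤ δ := by
  set F : ℕ+ → Set.Icc 0 T → ℝ := fun L t =>
    EllOne.total (u t) - ∑ ℓ ∈ Finset.Icc 1 L, EllOne.coord ℓ (u t) with hF
  have hc : ∀ L, Continuous (F L) := by
    intro L
    have h1 : Continuous fun t => (u t : EllOne) := continuous_subtype_val.comp u.continuous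
    fun_prop
  have hmono : ∀ t, Antitone fun L => F L t := by
    intro t L L' hL
    refine sub_le_sub_left ?_ _
    exact Finset.sum_le_sum_of_subset_of_nonneg (Finset.Icc_subset_Icc_right hL)
      fun ℓ _ _ => (u t).2.1 ℓ
  have hlim : ∀ t, Tendsto (fun L => F L t) atTop (𝓝 0) := by
    intro t
    have h1 : Tendsto (fun L : ℕ+ => ∑ ℓ ∈ Finset.Icc 1 L, (u t : EllOne) ℓ) atTop
        (𝓝 (EllOne.total (u t))) := by
      refine (u t : EllOne).summable_abs.of_abs.hasSum.comp ?_
      exact tendsto_atTop_finset_of_monotone (fun _ _ h => Finset.Icc_subset_Icc_right h)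
        fun ℓ => ⟨ℓ, Finset.mem_Icc.2 ⟨one_le, le_rfl⟩⟩
    have h2 := h1.const_sub (EllOne.total (u t))
    rwa [sub_self] at h2
  -- Dini's theorem on the compact interval [0,T].
  have hunif := Antitone.tendstoUniformly_of_forall_tendsto hc
    (fun _ _ h t => hmono t h) continuous_const hlim
  rw [Metric.tendstoUniformly_iff] at hunif
  obtain ⟨L₀, hL₀⟩ := eventually_atTop.1 (hunif δ hδ)
  refine ⟨L₀, fun L hL t => ?_⟩
  have := hL₀ L hL (Set.projIcc 0 T hT t)
  rw [dist_comm, Real.dist_eq, sub_zero] at this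
  exact (le_abs_self _).trans this.le

/-- The expected deviation at a fixed time vanishes in the limit. -/
lemma tendsto_integral_deviation {K : CoagulationKernel} {T : ℝ} {hT : 0 ≤ T}
    {u : C(Set.Icc 0 T, MPlus)} (hu : IsWeakSolution K hT u)
    (hu0 : (u ⟨0, Set.left_mem_Icc.2 hT⟩ : EllOne) = deltaOne)
    {Ω : ℕ+ → Type*} [∀ n, MeasurableSpace (Ω n)] {P : ∀ n, Measure (Ω n)}
    [∀ n, IsProbabilityMeasure (P n)] {η : ∀ n : ℕ+, ℝ≥0 → Ω n → Config n}
    (hη : ∀ n : ℕ+, IsMarcusLushnikov K n (P n) (η n)) {t : ℝ≥0} (ht : (t : ℝ) ≤ T) :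
    Tendsto (fun n : ℕ+ => ∫ ω, deviation hT u t (η n t ω) ∂(P n)) atTop (𝓝 0) := by
  have hcoe : Tendsto (fun n : ℕ+ => (n : ℝ)) atTop atTop := by
    refine tendsto_natCast_atTop_atTop.comp (tendsto_atTop_atTop.2 fun b =>
      ⟨b.succPNat, fun a ha => ?_⟩)
    exact (Nat.le_succ b).trans (by exact_mod_cast ha)
  set E := Real.exp (6 * K.bound * T)
  have hE : 0 < E := Real.exp_pos _
  refine tendsto_order.2 ⟨fun b hb => Eventually.of_forall fun n =>
    hb.trans_le (integral_nonneg fun ω => deviation_nonneg _ _), fun ε hε => ?_⟩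
  -- Three contributions survive as n tends to infinity: L·a = δ, 1/L < δ and the tail bound δ of u.
  -- Multiplied by E they stay below 3ε/4.
  set δ := ε / (4 * E) with hδdef
  have hδ : 0 < δ := by positivity
  obtain ⟨L₀, hL₀⟩ := exists_tail_le hT u hδ
  obtain ⟨L, hLL₀, hL⟩ : ∃ L ≥ L₀, 1 / (L : ℝ) < δ := by
    have h1 : Tendsto (fun L : ℕ+ => 1 / (L : ℝ)) atTop (𝓝 0) :=
      tendsto_const_nhds.div_atTop hcoe
    exact ((eventually_ge_atTop L₀).and (h1.eventually_lt_const hδ)).exists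
  have hLpos : (0 : ℝ) < L := by exact_mod_cast L.pos
  set a := δ / L with ha
  have hapos : 0 < a := by positivity
  have hlim : Tendsto (fun n : ℕ+ => (T * (L * (3 * K.bound / n))
      + L * (a + T * (9 * K.bound / n) / a) + 1 / (L : ℝ) + δ) * E) atTop
      (𝓝 ((T * (L * 0) + L * (a + T * 0 / a) + 1 / (L : ℝ) + δ) * E)) := by
    have h1 : ∀ c : ℝ, Tendsto (fun n : ℕ+ => c / (n : ℝ)) atTop (𝓝 0) := fun c =>
      tendsto_const_nhds.div_atTop hcoe
    exact ((((((h1 _).const_mul _).const_mul _).add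
      (((((h1 _).const_mul _).div_const _).const_add _).const_mul _)).add_const _).add_const
      _).mul_const _
  have hlt : (T * (L * 0) + L * (a + T * 0 / a) + 1 / (L : ℝ) + δ) * E < ε := by
    have h1 : L * a = δ := by
      rw [ha]
      field_simp
    have h2 : δ * E = ε / 4 := by
      rw [hδdef]
      field_simp
    have h3 : 1 / (L : ℝ) * E < δ * E := mul_lt_mul_of_pos_right hL hE
    have h4 : (T * (L * 0) + L * (a + T * 0 / a) + 1 / (L : ℝ) + δ) * E
        = L * a * E + 1 / (L : ℝ) * E + δ * E := by
      simp only [mul_zero, zero_div, add_zero, zero_add]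
      ring
    rw [h4, h1]
    linarith
  filter_upwards [hlim.eventually_lt_const hlt] with n hn
  exact ((hη n).integral_deviation_le hu hu0 n.pos L (hL₀ L hLL₀) hδ.le ht hapos).trans_lt hn

/-! ### Uniform convergence in time -/

/-- The points of a grid of mesh `h` in `[0,T]`. -/
def gridTime (T : ℝ) (h : ℝ≥0) (j : ℕ) : ℝ≥0 := min (j * h) T.toNNReal

lemma gridTime_mem {T : ℝ} (hT : 0 ≤ T) (h : ℝ≥0) (j : ℕ) : (gridTime T h j : ℝ) ∈ Set.Icc 0 T := by
  refine ⟨NNReal.coe_nonneg _, ?_⟩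
  have : gridTime T h j ≤ T.toNNReal := min_le_right _ _
  exact (NNReal.coe_le_coe.2 this).trans_eq (Real.coe_toNNReal T hT)

/-- The index is ⌊t/h⌋. Truncation at T keeps the right neighbour inside [0,T] and can only shorten
a step. -/
lemma exists_gridTime {T : ℝ} (hT : 0 ≤ T) {h : ℝ≥0} (hh : 0 < h) {t : ℝ≥0} (ht : (t : ℝ) ≤ T) :
    ∃ j ≤ ⌊(T.toNNReal / h : ℝ≥0)⌋₊, gridTime T h j ≤ t ∧ t ≤ gridTime T h (j + 1) ∧
      gridTime T h (j + 1) ≤ gridTime T h j + h := by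
  have ht' : t ≤ T.toNNReal := by rwa [← NNReal.coe_le_coe, Real.coe_toNNReal T hT]
  refine ⟨⌊t / h⌋₊, Nat.floor_le_floor (by gcongr), ?_, ?_, ?_⟩
  · refine (min_le_left _ _).trans ?_
    rw [← le_div_iff₀ hh]
    exact Nat.floor_le zero_le
  · refine le_min ?_ ht'
    rw [← div_le_iff₀ hh]
    push_cast
    exact (Nat.lt_floor_add_one _).le
  · unfold gridTime
    rw [min_add]
    refine min_le_min ?_ le_self_add
    push_cast
    rw [add_one_mul]

/-- Along a path of reachable configurations, the deviation is controlled by its values on a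
grid, because the number of particles is monotone. -/
lemma deviation_le_of_grid {K : CoagulationKernel} {T : ℝ} {hT : 0 ≤ T}
    {u : C(Set.Icc 0 T, MPlus)} (hu : IsWeakSolution K hT u) {n : ℕ} {x : ℝ≥0 → Config n}
    (hx : ∀ s t, s ≤ t → x t ∈ reachable (x s)) {s t r h : ℝ≥0} (hst : s ≤ t) (htr : t ≤ r)
    (hrs : r ≤ s + h) (hr : (r : ℝ) ≤ T) {δ : ℝ} (hs : deviation hT u s (x s) ≤ δ)
    (hr' : deviation hT u r (x r) ≤ δ) :
    deviation hT u t (x t) ≤ 7 * δ + 12 * K.bound * h := by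
  have hK := K.bound_nonneg
  have hst' : (s : ℝ) ≤ t := hst
  have htr' : (t : ℝ) ≤ r := htr
  have hrs' : (r : ℝ) ≤ s + h := by exact_mod_cast hrs
  have hsI : (s : ℝ) ∈ Set.Icc 0 T := ⟨s.coe_nonneg, by linarith⟩
  have htI : (t : ℝ) ∈ Set.Icc 0 T := ⟨t.coe_nonneg, by linarith⟩
  have hrI : (r : ℝ) ∈ Set.Icc 0 T := ⟨r.coe_nonneg, hr⟩
  set W := extendPath hT u
  have w1 : ‖W t - W s‖ ≤ 3 * K.bound * h := by
    refine (hu.norm_sub_le hsI htI).trans (mul_le_mul_of_nonneg_left ?_ (by positivity))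
    rw [abs_of_nonneg (by linarith)]
    linarith
  have w2 : ‖W r - W s‖ ≤ 3 * K.bound * h := by
    refine (hu.norm_sub_le hsI hrI).trans (mul_le_mul_of_nonneg_left ?_ (by positivity))
    rw [abs_of_nonneg (by linarith)]
    linarith
  have p1 := (hx s t hst).2
  have p2 := (norm_nonneg _).trans (hx t r htr).2
  set a : EllOne := (empiricalDensity (x s) : EllOne) with ha
  set b : EllOne := (empiricalDensity (x t) : EllOne) with hb
  set c : EllOne := (empiricalDensity (x r) : EllOne) with hc
  -- Monotonicity of the total gives ‖b - a‖ ≤ 3(total a - total c) ≤ 3(δ + 3Ch + δ). Adding ‖a - W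
  -- s‖ ≤ δ and ‖W t - W s‖ ≤ 3Ch yields 7δ + 12Ch.
  have q1 := (le_abs_self _).trans (EllOne.abs_total_le (a - W s))
  have q2 := (neg_le_abs _).trans (EllOne.abs_total_le (W r - W s))
  have q3 := (neg_le_abs _).trans (EllOne.abs_total_le (c - W r))
  rw [map_sub] at q1 q2 q3
  change ‖a - W s‖ ≤ δ at hs
  change ‖c - W r‖ ≤ δ at hr'
  change ‖b - W t‖ ≤ _
  have e : b - W t = (b - a) + (a - W s) - (W t - W s) := by abel
  have e1 := norm_sub_le ((b - a) + (a - W s)) (W t - W s)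
  have e2 := norm_add_le (b - a) (a - W s)
  rw [e]
  linarith

/-- The identity is an admissible time change, so the J₁ distance is at most the uniform distance.
-/
lemma edist_empiricalPath_le {T : ℝ} {hT : 0 ≤ T} {u : C(Set.Icc 0 T, MPlus)} {n : ℕ}
    {x : ℝ≥0 → Config n} (hx : IsCadlag x) {r : ℝ≥0}
    (h : ∀ t : ℝ≥0, (t : ℝ) ≤ T → deviation hT u t (x t) ≤ r) :
    edist (empiricalPath T x hx) (SkorohodSpace.ofContinuous u) ≤ r := by
  refine iInf_le_of_le (OrderIso.refl _) (max_le (by simp) (iSup_le fun t => ?_))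
  have ht := h ⟨t, t.2.1⟩ t.2.2
  rw [edist_nndist, ENNReal.coe_le_coe, ← NNReal.coe_le_coe, coe_nndist, Subtype.dist_eq,
    dist_eq_norm]
  change ‖_ - extendPath hT u t‖ ≤ _ at ht
  rwa [extendPath_coe] at ht

lemma tendstoInProbability_empiricalPath {K : CoagulationKernel} {T : ℝ} {hT : 0 ≤ T}
    {u : C(Set.Icc 0 T, MPlus)} (hu : IsWeakSolution K hT u)
    (hu0 : (u ⟨0, Set.left_mem_Icc.2 hT⟩ : EllOne) = deltaOne)
    {Ω : ℕ+ → Type*} [∀ n, MeasurableSpace (Ω n)] {P : ∀ n, Measure (Ω n)}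
    [∀ n, IsProbabilityMeasure (P n)] {η : ∀ n : ℕ+, ℝ≥0 → Ω n → Config n}
    (hη : ∀ n : ℕ+, IsMarcusLushnikov K n (P n) (η n)) :
    TendstoInProbability P (fun n ω => empiricalPath T (fun t => η n t ω) ((hη n).cadlag ω))
      (SkorohodSpace.ofContinuous u) := by
  intro ε hε
  obtain ⟨r, hr0, hrε⟩ := ENNReal.lt_iff_exists_nnreal_btwn.1 hε
  have hr : 0 < r := by exact_mod_cast hr0
  have hK := K.bound_nonneg
  -- With this δ and the next h, both 7δ and 12Ch are at most r/2; the `+ 1` in h covers C = 0.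
  set δ : ℝ := r / 14 with hδdef
  have hδ : 0 < δ := by positivity
  set h : ℝ≥0 := r / (24 * (K.bound.toNNReal + 1)) with hh
  have hh0 : 0 < h := by positivity
  have hhr : 12 * K.bound * h ≤ r / 2 := by
    have hcoe : (h : ℝ) = r / (24 * (K.bound + 1)) := by
      rw [hh]
      push_cast
      rw [Real.coe_toNNReal _ hK]
    rw [hcoe, mul_div_assoc', div_le_div_iff₀ (by positivity) (by positivity)]
    nlinarith [r.coe_nonneg]
  -- Both neighbours j and j + 1 of a time in [0,T] must be below N, while j may equal the floor. N
  -- does not depend on n.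
  set N := ⌊(T.toNNReal / h : ℝ≥0)⌋₊ + 2
  have hbound : ∀ n : ℕ+,
      P n {ω | ε ≤ edist (empiricalPath T (fun t => η n t ω) ((hη n).cadlag ω))
        (SkorohodSpace.ofContinuous u)}
      ≤ ∑ j ∈ Finset.range N, ENNReal.ofReal
        ((∫ ω, deviation hT u (gridTime T h j) (η n (gridTime T h j) ω) ∂(P n)) / δ) := by
    intro n
    -- If the deviation is at most δ at all grid times, it is at most r < ε at all times. The union
    -- bound and Markov's inequality then leave finitely many expectations.
    calc _ ≤ P n (⋃ j ∈ Finset.range N,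
            {ω | δ ≤ deviation hT u (gridTime T h j) (η n (gridTime T h j) ω)}) := by
          refine measure_mono_ae ?_
          filter_upwards [(hη n).ae_forall_mem_reachable] with ω hω hmem
          by_contra hcon
          have hlt : ∀ j < N,
              deviation hT u (gridTime T h j) (η n (gridTime T h j) ω) ≤ δ := by
            intro j hj
            by_contra hj'
            exact hcon (Set.mem_biUnion (Finset.mem_range.2 hj) (not_le.1 hj').le)
          have hle := edist_empiricalPath_le (hT := hT) (u := u) ((hη n).cadlag ω) (r := r)
            fun t ht => by
              obtain ⟨j, hj, h1, h2, h3⟩ := exists_gridTime hT hh0 ht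
              have := deviation_le_of_grid hu hω h1 h2 h3 (gridTime_mem hT h _).2
                (hlt j (by omega)) (hlt (j + 1) (by omega))
              linarith
          exact absurd (hrε.trans_le hmem) (not_lt.2 hle)
      _ ≤ ∑ j ∈ Finset.range N,
            P n {ω | δ ≤ deviation hT u (gridTime T h j) (η n (gridTime T h j) ω)} :=
          measure_biUnion_finset_le _ _
      _ ≤ _ := by
          refine Finset.sum_le_sum fun j _ => ?_
          have := mul_meas_ge_le_integral_of_nonneg
            (Eventually.of_forall fun ω => deviation_nonneg _ _)
            ((hη n).integrable_comp (gridTime T h j) (abs_deviation_le (hT := hT) (u := u)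
              (gridTime T h j))) δ
          rw [← ENNReal.ofReal_toReal (measure_ne_top (P n) _)]
          refine ENNReal.ofReal_le_ofReal ?_
          rw [le_div_iff₀ hδ, mul_comm]
          exact this
  refine tendsto_of_tendsto_of_tendsto_of_le_of_le tendsto_const_nhds ?_ (fun _ => zero_le) hbound
  have hz : (0 : ℝ≥0∞) = ∑ j ∈ Finset.range N, ENNReal.ofReal (0 / δ) := by simp
  rw [hz]
  refine tendsto_finsetSum _ fun j _ => ENNReal.tendsto_ofReal ?_
  exact (tendsto_integral_deviation hu hu0 hη (gridTime_mem hT h j).2).div_const δ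

end

theorem theorem2p3 (K : CoagulationKernel) (T : ℝ) (hT : 0 < T) :
    ∃ u : C(Set.Icc 0 T, MPlus),
      (IsWeakSolution K hT.le u ∧ (u ⟨0, Set.left_mem_Icc.2 hT.le⟩ : EllOne) = deltaOne) ∧
      (∀ v : C(Set.Icc 0 T, MPlus), IsWeakSolution K hT.le v →
        (v ⟨0, Set.left_mem_Icc.2 hT.le⟩ : EllOne) = deltaOne → v = u) ∧
      ∀ (Ω : ℕ+ → Type*) [∀ n, MeasurableSpace (Ω n)] (P : ∀ n, Measure (Ω n))
        [∀ n, IsProbabilityMeasure (P n)] (η : ∀ n : ℕ+, ℝ≥0 → Ω n → Config n)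
        (hη : ∀ n : ℕ+, IsMarcusLushnikov K n (P n) (η n)),
        TendstoInProbability P
          (fun n ω => empiricalPath T (fun t => η n t ω) ((hη n).cadlag ω))
          (SkorohodSpace.ofContinuous u) := by
  obtain ⟨u, hu⟩ := exists_isFixedPt_mildPath K hT.le ⟨pointMass 1, pointMass_mem 1⟩
  obtain ⟨hw, h0⟩ := isWeakSolution_of_isFixedPt K hT.le _ hu
  have h0' : (u ⟨0, Set.left_mem_Icc.2 hT.le⟩ : EllOne) = deltaOne := by
    rw [h0]
    exact pointMass_one
  exact ⟨u, ⟨hw, h0'⟩, fun v hv hv0 => hv.unique hw (hv0.trans h0'.symm),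
    fun Ω _ P _ η hη => tendstoInProbability_empiricalPath hw h0' hη⟩
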